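/- Let $\mathbb D\subset\mathbb C$ be the unit disk with its Poincaré metric $\frac{2|dz|}{1-|z|^2}$, and let $T^1\mathbb D$ be its unit tangent bundle, identified with $PSL(2,\mathbb R)$ by letting $g$ correspond to the image of the upward unit vector at $i$ in the upper half-plane under the derivative of $g$ followed by that of the Cayley transform $\tau\mapsto\frac{\tau-i}{\tau+i}$. The affine group $B=\left\{\begin{pmatrix}a&b\\0&a^{-1}\end{pmatrix}: a,b\in\mathbb R,\ a>0\right\}$ acts on $T^1\mathbb D\simeq PSL(2,\mathbb R)$ by right translation. Let $U\subset\mathbb D$ be an open disk, $T^1U$ its unit tangent bundle and $p:T^1U\to U$ the canonical projection. A (positive Borel) measure $\nu$ on $T^1U$ is called invariant under small elements of the affine group if for every continuous real-valued function $f$ with compact support in $T^1U$ (extended by $0$ to $T^1\mathbb D$) one has $\int f\,d\nu=\int (f\circ A)\,d\nu$ for all $A\in B$ sufficiently close to the identity. Let $\mu$ be a probability measure on $U$. Then there is at most one measure $\nu$ on $T^1U$ that is invariant under small elements of the affine group and satisfies $p_*\nu=\mu$. Moreover, identify $T^1U$ with $U\times S^1$ by letting $(z,\theta)$ correspond to the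 unit vector at $z$ pointing along the geodesic ray of $\mathbb D$ that ends at the point at infinity $\theta\in S^1$, and let $k(z,\theta)=\frac{1-|z|^2}{|\theta-z|^2}$ be the Poisson kernel and $dz$ the hyperbolic area. If such a $\nu$ exists, then there is a finite positive Borel measure $\varphi$ on $S^1$ such that $$\int F\,d\nu=\int_{S^1}\int_U F(z,\theta)\,k(z,\theta)\,dz\,d\varphi(\theta)$$ for every measurable $F:T^1U\to[0,\infty]$, and $\varphi$ is the only finite positive Borel measure on $S^1$ such that $\int G\,d\mu=\int_{S^1}\int_U G(z)\,k(z,\theta)\,dz\,d\varphi(\theta)$ for every measurable $G:U\to[0,\infty]$. -/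

import Mathlib

open MeasureTheory Filter Topology Complex
open scoped ENNReal MatrixGroups ComplexConjugate

namespace AffineLift

/-- The unit disk `𝔻` in `ℂ`, carrying the Poincaré metric `2 |dz| / (1 - |z|²)` (curvature `-1`). -/
def disk : Set ℂ := Metric.ball 0 1

lemma mem_disk {z : ℂ} : z ∈ disk ↔ ‖z‖ < 1 := by simp [disk]

/-- The unit tangent bundle `T¹U` of `U ⊆ 𝔻`: pairs (base point, tangent vector) such that the
tangent vector has length one, `2 ‖v‖ / (1 - ‖z‖²) = 1`, for the Poincaré metric. It carries the
topology and the Borel `σ`-algebra induced from `ℂ × ℂ`. -/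
def unitTangent (U : Set ℂ) : Set (ℂ × ℂ) := {ζ | ζ.1 ∈ U ∧ 2 * ‖ζ.2‖ = 1 - ‖ζ.1‖ ^ 2}

/-- The canonical projection `p : T¹U → U`. -/
def proj {U : Set ℂ} (ζ : unitTangent U) : U := ⟨ζ.1.1, ζ.2.1⟩

lemma unitTangent_mono {U : Set ℂ} (hU : U ⊆ disk) : unitTangent U ⊆ unitTangent disk :=
  fun _ h => ⟨hU h.1, h.2⟩

/-- The inclusion `T¹U ⊆ T¹𝔻`. -/
def incl {U : Set ℂ} (hU : U ⊆ disk) (ζ : unitTangent U) : unitTangent disk :=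
  Set.inclusion (unitTangent_mono hU) ζ

section Action

/-- Membership in the disk and unit length can be checked on one identity. -/
lemma mem_unitTangent_disk {w ξ : ℂ} (h : 2 * ‖ξ‖ = 1 - ‖w‖ ^ 2) (hξ : ξ ≠ 0) :
    (w, ξ) ∈ unitTangent disk := by
  refine ⟨?_, h⟩
  rw [mem_disk]
  have : 0 < ‖ξ‖ := norm_pos_iff.2 hξ
  nlinarith [norm_nonneg w]

lemma denom_ne_zero (g : SL(2, ℝ)) : (g 1 0 : ℂ) * I + g 1 1 ≠ 0 := by
  intro h
  have h1 := congrArg Complex.im h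
  have h2 := congrArg Complex.re h
  have h3 := g.det_coe
  simp at h1 h2
  rw [Matrix.det_fin_two] at h3
  simp [h1, h2] at h3

lemma cayley_denom_ne_zero (g : SL(2, ℝ)) :
    ((g 0 0 : ℂ) * I + g 0 1) / ((g 1 0 : ℂ) * I + g 1 1) + I ≠ 0 := by
  have hd := denom_ne_zero g
  intro h
  have h0 : ((g 0 0 : ℂ) * I + g 0 1) + I * ((g 1 0 : ℂ) * I + g 1 1) = 0 := by
    have h5 : (((g 0 0 : ℂ) * I + g 0 1) / ((g 1 0 : ℂ) * I + g 1 1) + I)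
        * ((g 1 0 : ℂ) * I + g 1 1) = 0 := by rw [h, zero_mul]
    rwa [add_mul, div_mul_cancel₀ _ hd] at h5
  have h1 := congrArg Complex.im h0
  have h2 := congrArg Complex.re h0
  have h3 := g.det_coe
  rw [Matrix.det_fin_two] at h3
  simp at h1 h2
  have e1 : g 1 1 = - g 0 0 := by linarith
  have e2 : g 1 0 = g 0 1 := by linarith
  rw [e1, e2] at h3
  nlinarith [sq_nonneg (g 0 0), sq_nonneg (g 0 1)]

lemma frame_mem (g : SL(2, ℝ)) :
    let δ : ℂ := (g 1 0 : ℂ) * I + g 1 1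
    let τ : ℂ := ((g 0 0 : ℂ) * I + g 0 1) / δ
    ((τ - I) / (τ + I), 2 * I / (τ + I) ^ 2 * (I / δ ^ 2)) ∈ unitTangent disk := by
  intro δ τ
  have hδ : δ ≠ 0 := denom_ne_zero g
  have hτ : τ + I ≠ 0 := cayley_denom_ne_zero g
  have him : τ.im * ‖δ‖ ^ 2 = 1 := by
    have h3 := g.det_coe
    rw [Matrix.det_fin_two] at h3
    have hn : normSq δ ≠ 0 := by simpa using hδ
    rw [← normSq_eq_norm_sq]
    simp only [τ, div_im]
    field_simp
    simp [δ]
    linear_combination h3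
  have key : ‖τ + I‖ ^ 2 - ‖τ - I‖ ^ 2 = 4 * τ.im := by
    rw [← normSq_eq_norm_sq, ← normSq_eq_norm_sq, normSq_apply, normSq_apply]
    simp
    ring
  apply mem_unitTangent_disk
  · have h1 : ‖τ + I‖ ≠ 0 := norm_ne_zero_iff.2 hτ
    have h2 : ‖δ‖ ≠ 0 := norm_ne_zero_iff.2 hδ
    simp only [norm_mul, norm_div, norm_pow, norm_I, Complex.norm_ofNat]
    field_simp
    linear_combination -4 * him - ‖δ‖ ^ 2 * key
  · simp [hδ, hτ]

/-- The identification of `PSL(2,ℝ)` with `T¹𝔻`: `g = (a b; c d)` goes to the image, under the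
derivative of `g` followed by the derivative of the Cayley transform `τ ↦ (τ - i) / (τ + i)`, of the
unit vector at `i` pointing upwards in the upper half-plane. Here `δ = c i + d`, `τ = g i`,
and the derivative of `g` at `i` is multiplication by `δ⁻²`. -/
noncomputable def frame (g : SL(2, ℝ)) : unitTangent disk :=
  ⟨_, frame_mem g⟩

lemma push_mem (ζ η : unitTangent disk) :
    let z : ℂ := ζ.1.1
    let u : ℂ := 2 * ζ.1.2 / (1 - ‖z‖ ^ 2 : ℝ)
    let w : ℂ := η.1.1
    ((u * w + z) / (1 + conj z * (u * w)),
      u * (1 - ‖z‖ ^ 2 : ℝ) / (1 + conj z * (u * w)) ^ 2 * η.1.2) ∈ unitTangent disk ∧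
    ‖u‖ = 1 ∧ 1 + conj z * (u * w) ≠ 0 := by
  intro z u w
  have hz : ‖z‖ < 1 := mem_disk.1 ζ.2.1
  have hw : ‖w‖ < 1 := mem_disk.1 η.2.1
  have hv : 2 * ‖ζ.1.2‖ = 1 - ‖z‖ ^ 2 := ζ.2.2
  have hx : 2 * ‖η.1.2‖ = 1 - ‖w‖ ^ 2 := η.2.2
  have hs : 0 < 1 - ‖z‖ ^ 2 := by nlinarith [norm_nonneg z]
  have ht : 0 < 1 - ‖w‖ ^ 2 := by nlinarith [norm_nonneg w]
  have hu : ‖u‖ = 1 := by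
    simp only [u, norm_div, norm_mul, Complex.norm_ofNat, Complex.norm_real, Real.norm_eq_abs,
      abs_of_pos hs, hv]
    exact div_self hs.ne'
  have hm : ‖u * w‖ = ‖w‖ := by rw [norm_mul, hu, one_mul]
  have key : ‖1 + conj z * (u * w)‖ ^ 2 - ‖u * w + z‖ ^ 2
      = (1 - ‖z‖ ^ 2) * (1 - ‖w‖ ^ 2) := by
    rw [← hm]
    simp only [← normSq_eq_norm_sq, normSq_apply]
    generalize u * w = m
    simp
    ring
  have hD : 1 + conj z * (u * w) ≠ 0 := by
    intro h
    rw [h] at key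
    have := mul_pos hs ht
    simp at key
    nlinarith [sq_nonneg ‖u * w + z‖]
  refine ⟨?_, hu, hD⟩
  have hD' : ‖1 + conj z * (u * w)‖ ≠ 0 := norm_ne_zero_iff.2 hD
  apply mem_unitTangent_disk
  · simp only [norm_mul, norm_div, norm_pow, hu, Complex.norm_real, Real.norm_eq_abs,
      abs_of_pos hs]
    generalize ‖1 + conj z * (u * w)‖ = D at hD' key ⊢
    rw [div_pow, one_mul]
    field_simp
    linear_combination (1 - ‖z‖ ^ 2) * hx - key
  · have h1 : u ≠ 0 := by rw [← norm_ne_zero_iff, hu]; exact one_ne_zero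
    have h2 : η.1.2 ≠ 0 := by rw [← norm_ne_zero_iff]; intro h; rw [h] at hx; linarith
    have h3 : ((1 - ‖z‖ ^ 2 : ℝ) : ℂ) ≠ 0 := by exact_mod_cast hs.ne'
    exact mul_ne_zero (div_ne_zero (mul_ne_zero h1 h3) (pow_ne_zero _ hD)) h2

/-- `push ζ η` is the image of `η ∈ T¹𝔻` under (the derivative of) the unique orientation preserving
isometry `ψ` of `𝔻` that carries the base vector `(0, 1/2)` to `ζ = (z, v)`; explicitly
`ψ w = (u w + z) / (1 + z̄ u w)` and `ψ' w = u (1 - |z|²) / (1 + z̄ u w)²`, with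
`u = 2 v / (1 - |z|²)`, a complex number of modulus one. -/
noncomputable def push (ζ η : unitTangent disk) : unitTangent disk :=
  ⟨_, (push_mem ζ η).1⟩

/-- The right action of `SL(2,ℝ)` (through `PSL(2,ℝ)`) on `T¹𝔻`: if `ζ` corresponds to `g`, then
`ζ · A` corresponds to `g A`; see `frame_surjective` and `rightAct_frame`. -/
noncomputable def rightAct (A : SL(2, ℝ)) (ζ : unitTangent disk) : unitTangent disk :=
  push ζ (frame A)

end Action

/-- The affine group `B`: the matrices `(a b; 0 a⁻¹)` with `a > 0`, under multiplication. -/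
def affineGroup : Subgroup SL(2, ℝ) where
  carrier := {A | A 1 0 = 0 ∧ 0 < A 0 0}
  one_mem' := by simp
  mul_mem' := by
    rintro A B ⟨hA, hA'⟩ ⟨hB, hB'⟩
    simp [Matrix.mul_apply, Fin.sum_univ_two, hA, hB, hA', hB']
  inv_mem' := by
    rintro A ⟨hA, hA'⟩
    have h := A.det_coe
    rw [Matrix.det_fin_two, hA, mul_zero, sub_zero] at h
    refine ⟨by simp [Matrix.SpecialLinearGroup.SL2_inv_expl, hA], ?_⟩
    have : 0 < A 1 1 := by
      by_contra h'
      nlinarith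
    simpa [Matrix.SpecialLinearGroup.SL2_inv_expl] using this

/-- Invariance of a measure `ν` on `T¹U` under small elements of the affine group: every continuous
`f` whose support is a compact subset of `T¹U` satisfies `∫ f dν = ∫ f ∘ A dν` for all `A` in a
neighbourhood (depending on `f`) of the identity of the affine group. -/
def InvariantSmall {U : Set ℂ} (hU : U ⊆ disk) (ν : Measure (unitTangent U)) : Prop :=
  ∀ f : unitTangent disk → ℝ, Continuous f → HasCompactSupport f →
    tsupport f ⊆ {ζ | ζ.1.1 ∈ U} →
    ∀ᶠ A : affineGroup in 𝓝 1,
      ∫ ζ, f (incl hU ζ) ∂ν = ∫ ζ, f (rightAct A (incl hU ζ)) ∂ν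

/-- Hyperbolic area on `U ⊆ 𝔻`. -/
noncomputable def area (U : Set ℂ) : Measure U :=
  (volume.withDensity fun z : ℂ => ENNReal.ofReal (4 / (1 - ‖z‖ ^ 2) ^ 2)).comap (↑)

/-- The circle `S¹` at infinity, with the topology and the Borel `σ`-algebra induced from `ℂ`. -/
def circle : Set ℂ := Metric.sphere 0 1

lemma toward_mem {z : ℂ} (hz : z ∈ disk) (θ : circle) :
    2 * ‖((1 - ‖z‖ ^ 2) / 2 : ℝ) * (((θ : ℂ) - z) / (1 - conj z * θ))‖ = 1 - ‖z‖ ^ 2 := by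
  have hz' : ‖z‖ < 1 := mem_disk.1 hz
  have hs : 0 < 1 - ‖z‖ ^ 2 := by nlinarith [norm_nonneg z]
  have hθ : ‖(θ : ℂ)‖ = 1 := mem_sphere_zero_iff_norm.1 θ.2
  have hne : (θ : ℂ) - z ≠ 0 := by
    intro h
    have : ‖z‖ = 1 := by rw [← sub_eq_zero.1 h, hθ]
    linarith
  have h : 1 - conj z * (θ : ℂ) = conj ((θ : ℂ) - z) * θ := by
    have : conj (θ : ℂ) * θ = 1 := by
      rw [mul_comm, Complex.mul_conj, normSq_eq_norm_sq, hθ]; simp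
    rw [map_sub, sub_mul, this]
  rw [h, norm_mul, norm_div, norm_mul, RCLike.norm_conj, hθ, mul_one,
    div_self (norm_ne_zero_iff.2 hne), Complex.norm_real, Real.norm_eq_abs, abs_of_pos (by linarith)]
  ring

/-- The identification `U × S¹ ≃ T¹U` in which the traces on `T¹U` of the orbits of the affine group
are the sets `U × {θ}`: the pair `(z, θ)` is the unit vector at `z` pointing along the geodesic
that ends at the point at infinity `θ`. -/
noncomputable def toward {U : Set ℂ} (hU : U ⊆ disk) (z : U) (θ : circle) : unitTangent U :=
  ⟨((z : ℂ), ((1 - ‖(z : ℂ)‖ ^ 2) / 2 : ℝ) * (((θ : ℂ) - z) / (1 - conj (z : ℂ) * θ))),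
    z.2, toward_mem (hU z.2) θ⟩

/-- The integral `∫_{S¹} ∫_U F(z, θ) k(z, θ) dz dφ(θ)` of a nonnegative function, where `k` is the
Poisson kernel `(1 - |z|²) / |θ - z|²` and `dz` is hyperbolic area. -/
noncomputable def poissonLIntegral {U : Set ℂ} (φ : Measure circle) (F : U → circle → ℝ≥0∞) : ℝ≥0∞ :=
  ∫⁻ θ, ∫⁻ z, F z θ * ENNReal.ofReal (poissonKernel 0 (z : ℂ) (θ : ℂ)) ∂(area U) ∂φ

section Check

/-- The numerator and the denominator of the base point of `frame g`. -/
noncomputable def num (g : SL(2, ℝ)) : ℂ := (g 0 1 + g 1 0 : ℝ) + (g 0 0 - g 1 1 : ℝ) * I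

/-- See `num`. -/
noncomputable def den (g : SL(2, ℝ)) : ℂ := (g 0 1 - g 1 0 : ℝ) + (g 0 0 + g 1 1 : ℝ) * I

lemma den_mul_conj (g : SL(2, ℝ)) : den g * conj (den g) = num g * conj (num g) + 4 := by
  have h := g.det_coe
  rw [Matrix.det_fin_two] at h
  have h' : (g 0 0 : ℂ) * g 1 1 - g 0 1 * g 1 0 = 1 := by exact_mod_cast h
  simp only [num, den, map_add, map_mul, conj_ofReal, conj_I]
  push_cast
  linear_combination 4 * h' - 4 * (g 0 0 * g 1 1 : ℂ) * I_sq

lemma den_ne_zero (g : SL(2, ℝ)) : den g ≠ 0 := by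
  intro h
  have h1 := den_mul_conj g
  rw [h, mul_conj] at h1
  have h2 := congrArg Complex.re h1
  simp at h2
  nlinarith [mul_self_nonneg (num g).re, mul_self_nonneg (num g).im]

lemma frame_eq (g : SL(2, ℝ)) : (frame g).1 = (num g / den g, -2 / den g ^ 2) := by
  have hδ := denom_ne_zero g
  have hq := den_ne_zero g
  have hp : ((g 0 0 : ℂ) * I + g 0 1) / ((g 1 0 : ℂ) * I + g 1 1) - I
      = num g / ((g 1 0 : ℂ) * I + g 1 1) := by
    rw [eq_div_iff hδ, sub_mul, div_mul_cancel₀ _ hδ]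
    simp only [num]
    push_cast
    linear_combination -(g 1 0 : ℂ) * I_sq
  have hq' : ((g 0 0 : ℂ) * I + g 0 1) / ((g 1 0 : ℂ) * I + g 1 1) + I
      = den g / ((g 1 0 : ℂ) * I + g 1 1) := by
    rw [eq_div_iff hδ, add_mul, div_mul_cancel₀ _ hδ]
    simp only [den]
    push_cast
    linear_combination (g 1 0 : ℂ) * I_sq
  simp only [frame, hp, hq', Prod.mk.injEq]
  constructor
  · field_simp
  · generalize (g 1 0 : ℂ) * I + g 1 1 = δ at hδ ⊢
    field_simp
    linear_combination I_sq

lemma frame_surjective : Function.Surjective frame := by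
  rintro ⟨⟨z, v⟩, hz, hv⟩
  simp only at hz hv
  have hz' : ‖z‖ < 1 := mem_disk.1 hz
  have hs : 0 < 1 - ‖z‖ ^ 2 := by nlinarith [norm_nonneg z]
  have hv0 : v ≠ 0 := by rw [← norm_ne_zero_iff]; intro h; rw [h] at hv; linarith
  obtain ⟨q, hq⟩ := IsAlgClosed.exists_pow_nat_eq (-2 / v) (n := 2) two_pos
  have hq0 : q ≠ 0 := by
    rintro rfl
    rw [zero_pow two_ne_zero] at hq
    exact div_ne_zero (by norm_num) hv0 hq.symm
  have hqn : ‖q‖ ^ 2 - ‖z * q‖ ^ 2 = 4 := by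
    have h1 : ‖q‖ ^ 2 * ‖v‖ = 2 := by
      rw [← norm_pow, hq, norm_div, div_mul_cancel₀ _ (norm_ne_zero_iff.2 hv0)]
      simp
    rw [norm_mul]
    linear_combination 2 * h1 - ‖q‖ ^ 2 * hv
  rw [← normSq_eq_norm_sq, ← normSq_eq_norm_sq, normSq_apply, normSq_apply] at hqn
  generalize hp : z * q = p at hqn
  have hdet : Matrix.det !![(q.im + p.im) / 2, (q.re + p.re) / 2; (p.re - q.re) / 2,
      (q.im - p.im) / 2] = 1 := by
    rw [Matrix.det_fin_two_of]
    linear_combination hqn / 4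
  let g : SL(2, ℝ) := ⟨_, hdet⟩
  have hn : num g = p := by
    apply Complex.ext <;> simp [num, g] <;> ring
  have hd : den g = q := by
    apply Complex.ext <;> simp [den, g] <;> ring
  refine ⟨g, Subtype.ext ?_⟩
  rw [frame_eq, hn, hd, hq, ← hp]
  simp [hq0]

lemma rightAct_frame (A g : SL(2, ℝ)) : rightAct A (frame g) = frame (g * A) := by
  have hq := den_ne_zero g
  have hQ := den_ne_zero A
  have hq' := den_ne_zero (g * A)
  have hcq : conj (den g) ≠ 0 := (map_ne_zero _).2 hq
  have e1 : 2 * I * den (g * A) = den g * den A - conj (num g) * num A := by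
    simp only [num, den, map_add, map_mul, conj_ofReal, conj_I, Matrix.SpecialLinearGroup.coe_mul,
      Matrix.mul_apply, Fin.sum_univ_two]
    push_cast
    ring_nf
    simp only [I_sq]
    ring
  have e2 : 2 * I * num (g * A) = num g * den A - conj (den g) * num A := by
    simp only [num, den, map_add, map_mul, conj_ofReal, conj_I, Matrix.SpecialLinearGroup.coe_mul,
      Matrix.mul_apply, Fin.sum_univ_two]
    push_cast
    ring_nf
    simp only [I_sq]
    ring
  have hs : ((1 - ‖num g / den g‖ ^ 2 : ℝ) : ℂ) = 4 / (den g * conj (den g)) := by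
    push_cast
    rw [← conj_mul', map_div₀, eq_div_iff (mul_ne_zero hq hcq)]
    field_simp
    linear_combination den_mul_conj g
  have hu : 2 * (-2 / den g ^ 2) / (4 / (den g * conj (den g))) = - conj (den g) / den g := by
    field_simp
    norm_num
  have hD : 1 + conj (num g / den g) * (- conj (den g) / den g * (num A / den A))
      = 2 * I * den (g * A) / (den g * den A) := by
    rw [e1, map_div₀]
    field_simp
    ring
  have hN : - conj (den g) / den g * (num A / den A) + num g / den g
      = 2 * I * num (g * A) / (den g * den A) := by
    rw [e2]
    field_simp
    ring
  apply Subtype.ext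
  simp only [rightAct, push, frame_eq, hs, hu, hD, hN, Prod.mk.injEq]
  constructor
  · field_simp
  · field_simp
    rw [I_sq]
    norm_num

end Check

end AffineLift

/-!
Let the Cayley transform that sends `∞` to `θ` give each unit vector pointing towards `θ` its
coordinates `x + i eᵗ`. The affine group acts by `(x, t, θ) ↦ (x + eᵗ x', t + t', θ)`, so its
orbits are the sets of constant `θ`, and the disk `U` meets each of them in a set that is convex
in the half-plane. Sliding a group element to the identity along a Euclidean segment of the
half-plane therefore keeps the product of two test functions supported in `T¹U`, and the local
invariance of `ν` upgrades to `∫ (f ∘ A) h dν = ∫ f (h ∘ A⁻¹) dν` for all `A ∈ B`. Integrating over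
`A` gives `∫ h J(f) dν = ∫ f J(h) dν`, where `J(f)(θ) = ∫ f dx dt` over the orbit of `θ`. For a
fixed bump function `h` this exhibits `ν` as `dx dt dφ(θ)`, which is `k(z, θ) dz dφ(θ)`.

For the uniqueness of `φ`, the Poisson integral of `φ` is, up to constants, the real part of a
Cauchy transform, which is holomorphic with the moments of `φ` as its Taylor coefficients. Its
values on an open set determine it on the disk, hence determine all moments of `φ`, and the moments
determine `φ` by Stone–Weierstrass.
-/

namespace AffineLift

/-! ### Cayley transforms -/

lemma norm_circle (θ : circle) : ‖(θ : ℂ)‖ = 1 := mem_sphere_zero_iff_norm.1 θ.2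

lemma circle_ne_zero (θ : circle) : (θ : ℂ) ≠ 0 :=
  ne_of_apply_ne norm (by simp [norm_circle])

lemma conj_circle (θ : circle) : conj (θ : ℂ) = (θ : ℂ)⁻¹ :=
  (Complex.inv_eq_conj (norm_circle θ)).symm

instance : CompactSpace circle := isCompact_iff_compactSpace.1 (isCompact_sphere _ _)

lemma one_sub_norm_sq_pos {z : ℂ} (hz : z ∈ disk) : 0 < 1 - ‖z‖ ^ 2 :=
  sub_pos.2 (pow_lt_one₀ (norm_nonneg z) (mem_disk.1 hz) two_ne_zero)

lemma ofReal_one_sub_norm_sq (z : ℂ) : ((1 - ‖z‖ ^ 2 : ℝ) : ℂ) = 1 - conj z * z := by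
  rw [Complex.conj_mul']
  push_cast
  rfl

lemma circle_sub_ne_zero {z : ℂ} (hz : z ∈ disk) (θ : circle) : (θ : ℂ) - z ≠ 0 := by
  refine sub_ne_zero.2 fun h => (mem_disk.1 hz).ne ?_
  rw [← h, norm_circle]

lemma one_sub_conj_mul_ne_zero {z u : ℂ} (hz : z ∈ disk) (hu : ‖u‖ ≤ 1) : 1 - conj z * u ≠ 0 := by
  refine sub_ne_zero.2 fun h => lt_irrefl (1 : ℝ) ?_
  calc (1 : ℝ) = ‖z‖ * ‖u‖ := by rw [← RCLike.norm_conj z, ← norm_mul, ← h, norm_one]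
    _ < 1 := mul_lt_one_of_nonneg_of_lt_one_left (norm_nonneg z) (mem_disk.1 hz) hu

lemma poissonKernel_pos {z : ℂ} (hz : z ∈ disk) (θ : circle) : 0 < poissonKernel 0 z θ := by
  have hne := norm_pos_iff.2 (circle_sub_ne_zero hz θ)
  rw [poissonKernel, sub_zero, sub_zero, norm_circle, one_pow]
  exact div_pos (one_sub_norm_sq_pos hz) (by positivity)

/-- The Cayley transform `w ↦ θ (w - i) / (w + i)`, which maps the upper half-plane onto the disk,
`i` to `0` and `∞` to `θ`. Division by zero gives `0` at `w = -i`, outside the half-plane. -/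
noncomputable def cayley (θ : circle) (w : ℂ) : ℂ := θ * ((w - I) / (w + I))

lemma add_I_ne_zero {w : ℂ} (hw : 0 < w.im) : w + I ≠ 0 := by
  intro h
  have him := congrArg Complex.im h
  simp only [add_im, I_im, zero_im] at him
  linarith

lemma one_sub_norm_cayley_sq {w : ℂ} (hw : 0 < w.im) (θ : circle) :
    1 - ‖cayley θ w‖ ^ 2 = 4 * w.im / ‖w + I‖ ^ 2 := by
  have h := norm_ne_zero_iff.2 (add_I_ne_zero hw)
  rw [cayley, norm_mul, norm_circle, one_mul, norm_div, div_pow]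
  field_simp
  simp only [← normSq_eq_norm_sq, normSq_apply, add_re, add_im, sub_re, sub_im, I_re, I_im]
  ring

lemma cayley_mem_disk {w : ℂ} (hw : 0 < w.im) (θ : circle) : cayley θ w ∈ disk := by
  have hpos : 0 < 1 - ‖cayley θ w‖ ^ 2 := by
    have := norm_pos_iff.2 (add_I_ne_zero hw)
    rw [one_sub_norm_cayley_sq hw]
    positivity
  exact mem_disk.2 ((sq_lt_one_iff₀ (norm_nonneg _)).1 (sub_pos.1 hpos))

lemma circle_sub_cayley {w : ℂ} (hw : 0 < w.im) (θ : circle) :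
    (θ : ℂ) - cayley θ w = θ * (2 * I) / (w + I) := by
  have := add_I_ne_zero hw
  rw [cayley]
  field_simp
  ring

lemma circle_add_cayley {w : ℂ} (hw : 0 < w.im) (θ : circle) :
    (θ : ℂ) + cayley θ w = θ * (2 * w) / (w + I) := by
  have := add_I_ne_zero hw
  rw [cayley]
  field_simp
  ring

lemma poissonKernel_cayley {w : ℂ} (hw : 0 < w.im) (θ : circle) :
    poissonKernel 0 (cayley θ w) θ = w.im := by
  have h := norm_ne_zero_iff.2 (add_I_ne_zero hw)
  rw [poissonKernel, sub_zero, sub_zero, norm_circle, one_pow, one_sub_norm_cayley_sq hw,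
    circle_sub_cayley hw]
  simp only [norm_mul, norm_circle, norm_div, Complex.norm_ofNat, norm_I]
  field_simp
  norm_num

/-- The inverse `z ↦ i (θ + z) / (θ - z)` of the Cayley transform `cayley θ`. -/
noncomputable def cayleyInv (θ : circle) (z : ℂ) : ℂ := I * ((θ + z) / (θ - z))

lemma cayleyInv_im (θ : circle) (z : ℂ) : (cayleyInv θ z).im = poissonKernel 0 z θ := by
  rw [poissonKernel_eq_re_herglotzRieszKernel, cayleyInv, I_mul_im]
  simp [herglotzRieszKernel]

lemma cayley_cayleyInv {z : ℂ} (hz : z ∈ disk) (θ : circle) : cayley θ (cayleyInv θ z) = z := by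
  have h := circle_sub_ne_zero hz θ
  have hθ := circle_ne_zero θ
  have hnum : cayleyInv θ z - I = 2 * I * z / (θ - z) := by
    rw [cayleyInv]
    field_simp
    ring
  have hden : cayleyInv θ z + I = 2 * I * θ / (θ - z) := by
    rw [cayleyInv]
    field_simp
    ring
  rw [cayley, hnum, hden]
  field_simp

lemma cayleyInv_cayley {w : ℂ} (hw : 0 < w.im) (θ : circle) : cayleyInv θ (cayley θ w) = w := by
  have h := add_I_ne_zero hw
  have hθ := circle_ne_zero θ
  rw [cayleyInv, circle_add_cayley hw, circle_sub_cayley hw]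
  field_simp

/-- The point `x + i eᵗ` of the upper half-plane. -/
noncomputable def halfPlanePt (x t : ℝ) : ℂ := x + (Real.exp t : ℂ) * I

@[simp] lemma halfPlanePt_re (x t : ℝ) : (halfPlanePt x t).re = x := by
  rw [halfPlanePt, add_re, re_ofReal_mul, ofReal_re, I_re, mul_zero, add_zero]

@[simp] lemma halfPlanePt_im (x t : ℝ) : (halfPlanePt x t).im = Real.exp t := by
  rw [halfPlanePt, add_im, im_ofReal_mul, ofReal_im, I_im, mul_one, zero_add]

lemma halfPlanePt_im_pos (x t : ℝ) : 0 < (halfPlanePt x t).im := by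
  rw [halfPlanePt_im]
  exact Real.exp_pos t

/-! ### Horocyclic coordinates on the unit tangent bundle -/

/-- The unit vector based at the image of `x + i eᵗ` under `cayley θ`, pointing to the point `θ` at
infinity: `x` is its position on a horocycle centred at `θ` and `t` is the height of that
horocycle. -/
noncomputable def orbitPt (x t : ℝ) (θ : circle) : unitTangent disk :=
  toward Set.Subset.rfl ⟨cayley θ (halfPlanePt x t), cayley_mem_disk (halfPlanePt_im_pos x t) θ⟩ θ

lemma orbitPt_fst (x t : ℝ) (θ : circle) :
    (orbitPt x t θ).1.1 = cayley θ (halfPlanePt x t) := rfl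

lemma toward_cayley_snd {w : ℂ} (hw : 0 < w.im) (θ : circle) :
    (toward Set.Subset.rfl ⟨cayley θ w, cayley_mem_disk hw θ⟩ θ).1.2
      = -2 * w.im * θ / (w + I) ^ 2 := by
  have hd := add_I_ne_zero hw
  have hcd : conj w - I ≠ 0 := by
    have := (map_ne_zero (starRingEnd ℂ)).2 hd
    rwa [map_add, conj_I, ← sub_eq_add_neg] at this
  have hθ := circle_ne_zero θ
  have hdir : 1 - conj (cayley θ w) * θ = -2 * I / (conj w - I) := by
    simp only [cayley, map_mul, map_div₀, map_sub, map_add, conj_I, conj_circle, sub_neg_eq_add,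
      ← sub_eq_add_neg]
    field_simp
    ring
  have hlen : (((1 - ‖cayley θ w‖ ^ 2) / 2 : ℝ) : ℂ) = 2 * w.im / ((w + I) * (conj w - I)) := by
    have hsq : (w + I) * (conj w - I) = ‖w + I‖ ^ 2 := by
      rw [← Complex.mul_conj', map_add, conj_I, sub_eq_add_neg]
    rw [one_sub_norm_cayley_sq hw, hsq]
    push_cast
    ring
  simp only [toward, hlen, hdir, circle_sub_cayley hw]
  field_simp

/-- The unit complex number `2 v / (1 - |z|²)` representing the direction of a unit vector
`(z, v)`. -/
noncomputable def direction (ζ : unitTangent disk) : ℂ := 2 * ζ.1.2 / (1 - ‖ζ.1.1‖ ^ 2 : ℝ)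

lemma norm_direction (ζ : unitTangent disk) : ‖direction ζ‖ = 1 := by
  have hs := one_sub_norm_sq_pos ζ.2.1
  rw [direction, norm_div, norm_mul, Complex.norm_ofNat, Complex.norm_real, Real.norm_eq_abs,
    abs_of_pos hs, ζ.2.2, div_self hs.ne']

lemma snd_eq_mul_direction (ζ : unitTangent disk) :
    ζ.1.2 = ((1 - ‖ζ.1.1‖ ^ 2 : ℝ) : ℂ) / 2 * direction ζ := by
  have : ((1 - ‖ζ.1.1‖ ^ 2 : ℝ) : ℂ) ≠ 0 := by exact_mod_cast (one_sub_norm_sq_pos ζ.2.1).ne'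
  rw [direction]
  field_simp

lemma one_add_conj_mul_direction (ζ : unitTangent disk) :
    1 + conj ζ.1.1 * direction ζ = direction ζ * conj (direction ζ + ζ.1.1) := by
  have hu : direction ζ * conj (direction ζ) = 1 := by
    rw [Complex.mul_conj', norm_direction, ofReal_one, one_pow]
  rw [map_add]
  linear_combination -hu

lemma one_add_conj_mul_direction_ne_zero (ζ : unitTangent disk) :
    1 + conj ζ.1.1 * direction ζ ≠ 0 := by
  rw [← sub_neg_eq_add, ← mul_neg]
  exact one_sub_conj_mul_ne_zero ζ.2.1 (by rw [norm_neg, norm_direction])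

/-- The point at infinity at which the geodesic ray spanned by a unit vector ends: the image of the
direction `u` under the isometry `w ↦ (w + z) / (1 + z̄ w)`, which carries `0` to the base point. -/
noncomputable def endpoint (ζ : unitTangent disk) : circle :=
  ⟨(direction ζ + ζ.1.1) / (1 + conj ζ.1.1 * direction ζ), by
    have hne : direction ζ + ζ.1.1 ≠ 0 := fun h =>
      one_add_conj_mul_direction_ne_zero ζ
        (by rw [one_add_conj_mul_direction, h, map_zero, mul_zero])
    rw [circle, mem_sphere_zero_iff_norm, one_add_conj_mul_direction, norm_div, norm_mul,
      RCLike.norm_conj, norm_direction, one_mul, div_self (norm_ne_zero_iff.2 hne)]⟩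

lemma toward_endpoint (ζ : unitTangent disk) :
    toward Set.Subset.rfl (proj ζ) (endpoint ζ) = ζ := by
  have hs : ((1 - ‖ζ.1.1‖ ^ 2 : ℝ) : ℂ) ≠ 0 := by exact_mod_cast (one_sub_norm_sq_pos ζ.2.1).ne'
  have hD := one_add_conj_mul_direction_ne_zero ζ
  have hnum : (endpoint ζ : ℂ) - ζ.1.1
      = direction ζ * ((1 - ‖ζ.1.1‖ ^ 2 : ℝ) : ℂ) / (1 + conj ζ.1.1 * direction ζ) := by
    rw [endpoint, ofReal_one_sub_norm_sq, div_sub' hD]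
    ring
  have hden : 1 - conj ζ.1.1 * (endpoint ζ : ℂ)
      = ((1 - ‖ζ.1.1‖ ^ 2 : ℝ) : ℂ) / (1 + conj ζ.1.1 * direction ζ) := by
    rw [endpoint, ofReal_one_sub_norm_sq]
    field_simp
    ring
  refine Subtype.ext (Prod.ext rfl ?_)
  simp only [toward, proj]
  rw [hnum, hden, div_div_div_cancel_right₀ hD, mul_div_cancel_right₀ _ hs, ofReal_div,
    ofReal_ofNat, ← snd_eq_mul_direction]

lemma toward_injective {U : Set ℂ} (hU : U ⊆ disk) (z : U) :
    Function.Injective (toward hU z) := by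
  intro θ θ' h
  have hz : ((1 - ‖(z : ℂ)‖ ^ 2 : ℝ) : ℂ) ≠ 0 := by
    exact_mod_cast (one_sub_norm_sq_pos (hU z.2)).ne'
  have hsnd := congrArg (fun ζ : unitTangent U => ζ.1.2) h
  simp only [toward, ofReal_div] at hsnd
  have hfrac := mul_left_cancel₀ (div_ne_zero hz (ofReal_ne_zero.2 two_ne_zero)) hsnd
  rw [div_eq_div_iff (one_sub_conj_mul_ne_zero (hU z.2) (norm_circle θ).le)
    (one_sub_conj_mul_ne_zero (hU z.2) (norm_circle θ').le)] at hfrac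
  apply Subtype.ext
  apply mul_right_cancel₀ hz
  rw [ofReal_one_sub_norm_sq]
  linear_combination hfrac

lemma endpoint_toward (z : disk) (θ : circle) :
    endpoint (toward Set.Subset.rfl z θ) = θ :=
  toward_injective Set.Subset.rfl z (toward_endpoint (toward Set.Subset.rfl z θ))

lemma continuous_direction : Continuous direction := by
  refine Continuous.div (by fun_prop) (by fun_prop) fun ζ => ?_
  exact_mod_cast (one_sub_norm_sq_pos ζ.2.1).ne'

lemma continuous_endpoint : Continuous endpoint := by
  have := continuous_direction
  exact Continuous.subtype_mk (Continuous.div (by fun_prop) (by fun_prop)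
    one_add_conj_mul_direction_ne_zero) _

/-- The first horocyclic coordinate of a unit vector: its position along a horocycle. -/
noncomputable def abscissa (ζ : unitTangent disk) : ℝ := (cayleyInv (endpoint ζ) ζ.1.1).re

/-- The second horocyclic coordinate of a unit vector: the height of the horocycle through its base
point, centred at its end point, as measured by the logarithm of the Poisson kernel. -/
noncomputable def height (ζ : unitTangent disk) : ℝ :=
  Real.log (poissonKernel 0 ζ.1.1 (endpoint ζ))

lemma halfPlanePt_coords (ζ : unitTangent disk) :
    halfPlanePt (abscissa ζ) (height ζ) = cayleyInv (endpoint ζ) ζ.1.1 := by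
  apply Complex.ext
  · rw [halfPlanePt_re, abscissa]
  · rw [halfPlanePt_im, height, Real.exp_log (poissonKernel_pos ζ.2.1 _), cayleyInv_im]

lemma continuous_cayleyInv_endpoint :
    Continuous fun ζ : unitTangent disk => cayleyInv (endpoint ζ) ζ.1.1 := by
  have hend : Continuous fun ζ => (endpoint ζ : ℂ) :=
    continuous_subtype_val.comp continuous_endpoint
  have hbase : Continuous fun ζ : unitTangent disk => ζ.1.1 := by fun_prop
  exact continuous_const.mul ((hend.add hbase).div (hend.sub hbase) fun ζ =>
    circle_sub_ne_zero ζ.2.1 _)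

lemma continuous_abscissa : Continuous abscissa :=
  continuous_re.comp continuous_cayleyInv_endpoint

lemma continuous_height : Continuous height := by
  refine Continuous.log ?_ fun ζ => (poissonKernel_pos ζ.2.1 _).ne'
  simp_rw [← cayleyInv_im]
  exact continuous_im.comp continuous_cayleyInv_endpoint

lemma orbitPt_coords (ζ : unitTangent disk) :
    orbitPt (abscissa ζ) (height ζ) (endpoint ζ) = ζ := by
  have hbase : cayley (endpoint ζ) (halfPlanePt (abscissa ζ) (height ζ)) = ζ.1.1 := by
    rw [halfPlanePt_coords, cayley_cayleyInv ζ.2.1]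
  conv_rhs => rw [← toward_endpoint ζ]
  exact congrArg (toward _ · _) (Subtype.ext hbase)

lemma endpoint_orbitPt (x t : ℝ) (θ : circle) : endpoint (orbitPt x t θ) = θ :=
  endpoint_toward _ _

lemma cayleyInv_orbitPt (x t : ℝ) (θ : circle) :
    cayleyInv θ (orbitPt x t θ).1.1 = halfPlanePt x t :=
  cayleyInv_cayley (halfPlanePt_im_pos x t) θ

lemma abscissa_orbitPt (x t : ℝ) (θ : circle) : abscissa (orbitPt x t θ) = x := by
  rw [abscissa, endpoint_orbitPt, cayleyInv_orbitPt, halfPlanePt_re]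

lemma height_orbitPt (x t : ℝ) (θ : circle) : height (orbitPt x t θ) = t := by
  rw [height, endpoint_orbitPt, ← cayleyInv_im, cayleyInv_orbitPt, halfPlanePt_im, Real.log_exp]

lemma continuous_toward {U : Set ℂ} (hU : U ⊆ disk) :
    Continuous fun p : U × circle => toward hU p.1 p.2 := by
  refine Continuous.subtype_mk (Continuous.prodMk (by fun_prop) ?_) _
  exact Continuous.mul (by fun_prop) (Continuous.div (by fun_prop) (by fun_prop) fun p =>
    one_sub_conj_mul_ne_zero (hU p.1.2) (norm_circle p.2).le)

lemma continuous_cayley_halfPlanePt :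
    Continuous fun p : ℝ × ℝ × circle => cayley p.2.2 (halfPlanePt p.1 p.2.1) := by
  unfold cayley halfPlanePt
  exact Continuous.mul (by fun_prop) (Continuous.div (by fun_prop) (by fun_prop) fun p =>
    add_I_ne_zero (halfPlanePt_im_pos p.1 p.2.1))

lemma continuous_orbitPt {X : Type*} [TopologicalSpace X] {x t : X → ℝ} {θ : X → circle}
    (hx : Continuous x) (ht : Continuous t) (hθ : Continuous θ) :
    Continuous fun a => orbitPt (x a) (t a) (θ a) :=
  (continuous_toward Set.Subset.rfl).comp
    (((continuous_cayley_halfPlanePt.comp (hx.prodMk (ht.prodMk hθ))).subtype_mk _).prodMk hθ)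

/-- Horocyclic coordinates on the unit tangent bundle. -/
noncomputable def horoCoords : unitTangent disk ≃ₜ ℝ × ℝ × circle where
  toFun ζ := (abscissa ζ, height ζ, endpoint ζ)
  invFun p := orbitPt p.1 p.2.1 p.2.2
  left_inv := orbitPt_coords
  right_inv p := by simp only [abscissa_orbitPt, height_orbitPt, endpoint_orbitPt]
  continuous_toFun := continuous_abscissa.prodMk (continuous_height.prodMk continuous_endpoint)
  continuous_invFun := continuous_orbitPt (by fun_prop) (by fun_prop) (by fun_prop)

instance : LocallyCompactSpace (unitTangent disk) :=
  horoCoords.isClosedEmbedding.locallyCompactSpace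

/-! ### The right action of the affine group -/

lemma rightAct_mul (A B : SL(2, ℝ)) (ζ : unitTangent disk) :
    rightAct (A * B) ζ = rightAct B (rightAct A ζ) := by
  obtain ⟨g, rfl⟩ := frame_surjective ζ
  rw [rightAct_frame, rightAct_frame, rightAct_frame, mul_assoc]

lemma rightAct_one (ζ : unitTangent disk) : rightAct 1 ζ = ζ := by
  obtain ⟨g, rfl⟩ := frame_surjective ζ
  rw [rightAct_frame, mul_one]

/-- The element of the affine group which acts on the upper half-plane by `τ ↦ eᵗ τ + x`, for
`p = (x, t)`. -/
noncomputable def aff (p : ℝ × ℝ) : affineGroup :=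
  ⟨⟨!![Real.exp (p.2 / 2), p.1 * Real.exp (-p.2 / 2); 0, Real.exp (-p.2 / 2)], by
    rw [Matrix.det_fin_two_of, mul_zero, sub_zero, ← Real.exp_add, ← add_div, add_neg_cancel,
      zero_div, Real.exp_zero]⟩, rfl, Real.exp_pos _⟩

lemma coe_aff (p : ℝ × ℝ) : ((aff p : SL(2, ℝ)) : Matrix (Fin 2) (Fin 2) ℝ) =
    !![Real.exp (p.2 / 2), p.1 * Real.exp (-p.2 / 2); 0, Real.exp (-p.2 / 2)] := rfl

lemma continuous_aff : Continuous aff := by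
  refine Continuous.subtype_mk (Continuous.subtype_mk (continuous_matrix fun i j => ?_) _) _
  fin_cases i <;> fin_cases j <;> simp only [Fin.zero_eta, Fin.isValue, Fin.mk_one,
    Matrix.of_apply, Matrix.cons_val', Matrix.cons_val_zero, Matrix.cons_val_one,
    Matrix.cons_val_fin_one] <;> fun_prop

lemma exp_half (t : ℝ) : Real.exp (t / 2) = Real.exp t * Real.exp (-t / 2) := by
  rw [← Real.exp_add]
  ring_nf

lemma aff_mul (p q : ℝ × ℝ) :
    aff p * aff q = aff (p.1 + Real.exp p.2 * q.1, p.2 + q.2) := by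
  have hadd : Real.exp ((p.2 + q.2) / 2) = Real.exp (p.2 / 2) * Real.exp (q.2 / 2) := by
    rw [← Real.exp_add, add_div]
  have hneg : Real.exp (-(p.2 + q.2) / 2) = Real.exp (-p.2 / 2) * Real.exp (-q.2 / 2) := by
    rw [← Real.exp_add, neg_add, add_div]
  have hcorner : Real.exp (p.2 / 2) * (q.1 * Real.exp (-q.2 / 2))
        + p.1 * Real.exp (-p.2 / 2) * Real.exp (-q.2 / 2)
      = (p.1 + Real.exp p.2 * q.1) * (Real.exp (-p.2 / 2) * Real.exp (-q.2 / 2)) := by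
    rw [exp_half p.2]
    ring
  apply Subtype.ext
  apply Subtype.ext
  rw [Subgroup.coe_mul, Matrix.SpecialLinearGroup.coe_mul, coe_aff, coe_aff, coe_aff,
    Matrix.mul_fin_two, hadd, hneg]
  simp only [mul_zero, zero_mul, zero_add, add_zero]
  rw [hcorner]

lemma num_aff (p : ℝ × ℝ) : num (aff p) = Real.exp (-p.2 / 2) * (halfPlanePt p.1 p.2 - I) := by
  simp only [num, halfPlanePt, coe_aff, exp_half p.2, Matrix.of_apply, Matrix.cons_val]
  push_cast
  ring

lemma den_aff (p : ℝ × ℝ) : den (aff p) = Real.exp (-p.2 / 2) * (halfPlanePt p.1 p.2 + I) := by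
  simp only [den, halfPlanePt, coe_aff, exp_half p.2, Matrix.of_apply, Matrix.cons_val]
  push_cast
  ring

/-- The rotation `τ ↦ (κ₁ τ + κ₂) / (-κ₂ τ + κ₁)` around `i`, for `κ = κ₁ + i κ₂`. -/
noncomputable def rot (κ : ℂ) (hκ : ‖κ‖ = 1) : SL(2, ℝ) :=
  ⟨!![κ.re, κ.im; -κ.im, κ.re], by
    rw [Matrix.det_fin_two_of, mul_neg, sub_neg_eq_add, ← normSq_apply, normSq_eq_norm_sq, hκ,
      one_pow]⟩

lemma coe_rot (κ : ℂ) (hκ : ‖κ‖ = 1) :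
    (rot κ hκ : Matrix (Fin 2) (Fin 2) ℝ) = !![κ.re, κ.im; -κ.im, κ.re] := rfl

lemma num_rot_mul (κ : ℂ) (hκ : ‖κ‖ = 1) (g : SL(2, ℝ)) : num (rot κ hκ * g) = κ * num g := by
  apply Complex.ext <;>
    simp [num, coe_rot, Matrix.SpecialLinearGroup.coe_mul, Matrix.mul_apply,
      Fin.sum_univ_two] <;> ring

lemma den_rot_mul (κ : ℂ) (hκ : ‖κ‖ = 1) (g : SL(2, ℝ)) :
    den (rot κ hκ * g) = conj κ * den g := by
  apply Complex.ext <;>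
    simp [den, coe_rot, Matrix.SpecialLinearGroup.coe_mul, Matrix.mul_apply,
      Fin.sum_univ_two] <;> ring

lemma frame_rot_mul_aff {κ : ℂ} (hκ : ‖κ‖ = 1) {θ : circle} (h : κ ^ 2 = θ) (p : ℝ × ℝ) :
    frame (rot κ hκ * aff p) = orbitPt p.1 p.2 θ := by
  have hκ0 : κ ≠ 0 := ne_of_apply_ne norm (by simp [hκ])
  have hd := add_I_ne_zero (halfPlanePt_im_pos p.1 p.2)
  have hexp : ((Real.exp p.2 : ℝ) : ℂ) * ((Real.exp (-p.2 / 2) : ℝ) : ℂ) ^ 2 = 1 := by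
    norm_cast
    rw [sq, ← mul_assoc, ← exp_half, ← Real.exp_add, ← add_div, add_neg_cancel, zero_div,
      Real.exp_zero]
  have he : ((Real.exp (-p.2 / 2) : ℝ) : ℂ) ≠ 0 := by exact_mod_cast (Real.exp_pos _).ne'
  apply Subtype.ext
  rw [frame_eq, num_rot_mul, den_rot_mul, num_aff, den_aff, ← Complex.inv_eq_conj hκ]
  refine Prod.ext ?_ ?_
  · rw [orbitPt_fst, cayley, ← h]
    field_simp
  · rw [orbitPt, toward_cayley_snd (halfPlanePt_im_pos _ _), ← h, halfPlanePt_im]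
    generalize ((Real.exp (-p.2 / 2) : ℝ) : ℂ) = e at he hexp ⊢
    field_simp
    linear_combination hexp

lemma rightAct_orbitPt (p : ℝ × ℝ) (x t : ℝ) (θ : circle) :
    rightAct (aff p) (orbitPt x t θ) = orbitPt (x + Real.exp t * p.1) (t + p.2) θ := by
  obtain ⟨κ, hκθ⟩ := IsAlgClosed.exists_pow_nat_eq (θ : ℂ) (n := 2) two_pos
  have hκ : ‖κ‖ = 1 := by
    rw [← pow_eq_one_iff_of_nonneg (norm_nonneg _) two_ne_zero, ← norm_pow, hκθ, norm_circle]
  rw [← frame_rot_mul_aff hκ hκθ (x, t), rightAct_frame, mul_assoc, ← Subgroup.coe_mul, aff_mul,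
    frame_rot_mul_aff hκ hκθ]

/-- Right translation by `aff p`, written in horocyclic coordinates; see `rightAct_aff`. -/
noncomputable def translate (p : ℝ × ℝ) : unitTangent disk ≃ₜ unitTangent disk where
  toFun ζ := orbitPt (abscissa ζ + Real.exp (height ζ) * p.1) (height ζ + p.2) (endpoint ζ)
  invFun ζ := orbitPt (abscissa ζ - Real.exp (height ζ - p.2) * p.1) (height ζ - p.2) (endpoint ζ)
  left_inv ζ := by
    simp only [abscissa_orbitPt, height_orbitPt, endpoint_orbitPt, add_sub_cancel_right,
      orbitPt_coords]
  right_inv ζ := by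
    simp only [abscissa_orbitPt, height_orbitPt, endpoint_orbitPt, sub_add_cancel, orbitPt_coords]
  continuous_toFun := continuous_orbitPt
    (continuous_abscissa.add ((Real.continuous_exp.comp continuous_height).mul continuous_const))
    (continuous_height.add continuous_const) continuous_endpoint
  continuous_invFun := continuous_orbitPt
    (continuous_abscissa.sub
      ((Real.continuous_exp.comp (continuous_height.sub continuous_const)).mul continuous_const))
    (continuous_height.sub continuous_const) continuous_endpoint

lemma translate_apply (p : ℝ × ℝ) (ζ : unitTangent disk) : translate p ζ =
    orbitPt (abscissa ζ + Real.exp (height ζ) * p.1) (height ζ + p.2) (endpoint ζ) := rfl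

lemma translate_symm_apply (p : ℝ × ℝ) (ζ : unitTangent disk) : (translate p).symm ζ =
    orbitPt (abscissa ζ - Real.exp (height ζ - p.2) * p.1) (height ζ - p.2) (endpoint ζ) := rfl

lemma translate_zero (ζ : unitTangent disk) : translate 0 ζ = ζ := by
  rw [translate_apply, Prod.fst_zero, Prod.snd_zero, mul_zero, add_zero, add_zero, orbitPt_coords]

lemma rightAct_aff (p : ℝ × ℝ) (ζ : unitTangent disk) : rightAct (aff p) ζ = translate p ζ := by
  conv_lhs => rw [← orbitPt_coords ζ, rightAct_orbitPt]
  rfl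

lemma rightAct_aff_inv (p : ℝ × ℝ) (ζ : unitTangent disk) :
    rightAct (aff p)⁻¹ ζ = (translate p).symm ζ := by
  rw [Homeomorph.eq_symm_apply, ← rightAct_aff, ← rightAct_mul, inv_mul_cancel, rightAct_one]

lemma continuous_translate {X : Type*} [TopologicalSpace X] {p : X → ℝ × ℝ}
    {ζ : X → unitTangent disk} (hp : Continuous p) (hζ : Continuous ζ) :
    Continuous fun a => translate (p a) (ζ a) := by
  have := continuous_abscissa.comp hζ
  have := continuous_height.comp hζ
  exact continuous_orbitPt (by fun_prop) (by fun_prop) (continuous_endpoint.comp hζ)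

lemma continuous_translate_symm {X : Type*} [TopologicalSpace X] {p : X → ℝ × ℝ}
    {ζ : X → unitTangent disk} (hp : Continuous p) (hζ : Continuous ζ) :
    Continuous fun a => (translate (p a)).symm (ζ a) := by
  have := continuous_abscissa.comp hζ
  have := continuous_height.comp hζ
  exact continuous_orbitPt (by fun_prop) (by fun_prop) (continuous_endpoint.comp hζ)

/-! ### Horoconvex sets -/

/-- A subset of the disk is horoconvex if its image under each inverse Cayley transform is convex
in the affine structure of the upper half-plane. The half-plane condition excludes the junk value
`cayley θ (-i) = 0`. -/
def IsHoroConvex (U : Set ℂ) : Prop := ∀ θ : circle, Convex ℝ {w : ℂ | 0 < w.im ∧ cayley θ w ∈ U}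

lemma cayley_mem_ball_iff {w : ℂ} (hw : 0 < w.im) (θ : circle) (c : ℂ) {r : ℝ} (hr : 0 ≤ r) :
    cayley θ w ∈ Metric.ball c r ↔
      normSq (θ * (w - I) - c * (w + I)) - r ^ 2 * normSq (w + I) < 0 := by
  have hd := add_I_ne_zero hw
  have hsub : cayley θ w - c = (θ * (w - I) - c * (w + I)) / (w + I) := by
    rw [cayley]
    field_simp
  rw [mem_ball_iff_norm, hsub, norm_div, div_lt_iff₀ (norm_pos_iff.2 hd), sub_neg,
    normSq_eq_norm_sq, normSq_eq_norm_sq, ← mul_pow]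
  exact (pow_lt_pow_iff_left₀ (norm_nonneg _) (by positivity) two_ne_zero).symm

/-- The quadratic part of the function is `(|θ - c|² - r²) |w|²`. -/
lemma convexOn_normSq_sub {c : ℂ} {r : ℝ} {θ : ℂ} (hr : 0 ≤ r) (hrθ : r ≤ ‖θ - c‖) :
    ConvexOn ℝ Set.univ
      fun w => normSq (θ * (w - I) - c * (w + I)) - r ^ 2 * normSq (w + I) := by
  refine ⟨convex_univ, fun w₀ _ w₁ _ a b ha hb hab => ?_⟩
  have hα : 0 ≤ normSq (θ - c) - r ^ 2 := by
    rw [normSq_eq_norm_sq, sub_nonneg]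
    exact pow_le_pow_left₀ hr hrθ 2
  have hdefect : 0 ≤ a * b * (normSq (θ - c) - r ^ 2) * normSq (w₁ - w₀) :=
    mul_nonneg (mul_nonneg (mul_nonneg ha hb) hα) (normSq_nonneg _)
  rw [← sub_nonneg]
  refine hdefect.trans_eq ?_
  obtain rfl : a = 1 - b := by linarith
  simp only [normSq_apply, add_re, add_im, sub_re, sub_im, mul_re, mul_im, I_re, I_im, smul_re,
    smul_im, smul_eq_mul]
  ring

lemma isHoroConvex_ball {c : ℂ} {r : ℝ} (hr : 0 ≤ r) (hU : Metric.ball c r ⊆ disk) :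
    IsHoroConvex (Metric.ball c r) := by
  intro θ
  have hrθ : r ≤ ‖(θ : ℂ) - c‖ := by
    by_contra! h
    exact (mem_disk.1 (hU (mem_ball_iff_norm.2 h))).ne (norm_circle θ)
  convert (convex_halfSpace_im_gt 0).inter ((convexOn_normSq_sub hr hrθ).convex_lt 0) using 1
  ext w
  simp only [Set.mem_ofPred_eq, Set.mem_inter_iff, Set.mem_univ, true_and]
  exact and_congr_right fun hw => cayley_mem_ball_iff hw θ c hr

/-- The height `τ` with `e^τ = (1 - s) + s eᵗ`: together with `s x` it parametrises the elements of
the affine group that move `i` along a Euclidean segment. -/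
noncomputable def segmentHeight (t s : ℝ) : ℝ := Real.log ((1 - s) + s * Real.exp t)

lemma one_sub_add_mul_exp_pos (t : ℝ) {s : ℝ} (hs : s ∈ Set.Icc 0 1) :
    0 < (1 - s) + s * Real.exp t := by
  rcases hs.1.eq_or_lt with rfl | hs0
  · norm_num
  · have := mul_pos hs0 (Real.exp_pos t)
    linarith [hs.2]

/-- The segment of group elements does not depend on the base point, since the half-plane coordinate
of `translate p ζ` is an affine function of `p.1` and `exp p.2`. -/
lemma IsHoroConvex.translate_segment_mem {U : Set ℂ} (hUc : IsHoroConvex U) {ζ : unitTangent disk}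
    {p : ℝ × ℝ} {s : ℝ} (hs : s ∈ Set.Icc 0 1) (h₀ : ζ.1.1 ∈ U) (h₁ : (translate p ζ).1.1 ∈ U) :
    (translate (s * p.1, segmentHeight p.2 s) ζ).1.1 ∈ U := by
  have hsegment : halfPlanePt (abscissa ζ + Real.exp (height ζ) * (s * p.1))
        (height ζ + segmentHeight p.2 s)
      = (1 - s) • halfPlanePt (abscissa ζ) (height ζ)
        + s • halfPlanePt (abscissa ζ + Real.exp (height ζ) * p.1) (height ζ + p.2) := by
    simp only [halfPlanePt, segmentHeight, Real.exp_add,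
      Real.exp_log (one_sub_add_mul_exp_pos p.2 hs), real_smul]
    push_cast
    ring
  rw [← orbitPt_coords ζ, orbitPt_fst] at h₀
  rw [translate_apply, orbitPt_fst] at h₁ ⊢
  rw [hsegment]
  exact (hUc (endpoint ζ) ⟨halfPlanePt_im_pos _ _, h₀⟩ ⟨halfPlanePt_im_pos _ _, h₁⟩
    (sub_nonneg.2 hs.2) hs.1 (sub_add_cancel 1 s)).2

/-! ### From small elements of the affine group to all elements -/

lemma continuous_incl {U : Set ℂ} (hU : U ⊆ disk) : Continuous (incl hU) :=
  continuous_inclusion (unitTangent_mono hU)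

/-- The continuous functions with compact support in `T¹U`, as functions on `T¹𝔻`; these are the
functions against which invariance is tested. -/
structure IsTest (U : Set ℂ) (f : unitTangent disk → ℝ) : Prop where
  continuous : Continuous f
  hasCompactSupport : HasCompactSupport f
  tsupport_subset : tsupport f ⊆ {ζ | ζ.1.1 ∈ U}

lemma IsTest.mul_left {U : Set ℂ} {f g : unitTangent disk → ℝ} (hf : IsTest U f)
    (hg : Continuous g) : IsTest U fun ζ => g ζ * f ζ :=
  ⟨hg.mul hf.continuous, hf.hasCompactSupport.mul_left,
    tsupport_mul_subset_right.trans hf.tsupport_subset⟩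

lemma IsTest.integrable {U : Set ℂ} (hU : U ⊆ disk) {f : unitTangent disk → ℝ} (hf : IsTest U f)
    (ν : Measure (unitTangent U)) [IsLocallyFiniteMeasure ν] :
    Integrable (fun ζ => f (incl hU ζ)) ν := by
  have hrange : tsupport f ⊆ Set.range (incl hU) := fun ζ hζ =>
    ⟨⟨ζ.1, hf.tsupport_subset hζ, ζ.2.2⟩, rfl⟩
  have hcompact : IsCompact (incl hU ⁻¹' tsupport f) :=
    (IsEmbedding.inclusion (unitTangent_mono hU)).isInducing.isCompact_preimage'
      hf.hasCompactSupport hrange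
  exact (hf.continuous.comp (continuous_incl hU)).integrable_of_hasCompactSupport
    (hcompact.of_isClosed_subset (isClosed_tsupport _)
      (tsupport_comp_subset_preimage f (continuous_incl hU)))

lemma IsTest.comp_translate_mul {U : Set ℂ} (hUc : IsHoroConvex U) {f h : unitTangent disk → ℝ}
    (hf : IsTest U f) (hh : IsTest U h) (p : ℝ × ℝ) {s : ℝ} (hs : s ∈ Set.Icc 0 1) :
    IsTest U ((fun ζ => f (translate p ζ) * h ζ) ∘
      (translate (s * p.1, segmentHeight p.2 s)).symm) := by
  set e := (translate (s * p.1, segmentHeight p.2 s)).symm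
  refine ⟨?_, hh.hasCompactSupport.mul_left.comp_homeomorph e, fun ζ hζ => ?_⟩
  · exact ((hf.continuous.comp (translate p).continuous).mul hh.continuous).comp e.continuous
  have heζ := tsupport_comp_subset_preimage _ e.continuous hζ
  have hstart : (e ζ).1.1 ∈ U := hh.tsupport_subset (tsupport_mul_subset_right heζ)
  have hend : (translate p (e ζ)).1.1 ∈ U := hf.tsupport_subset
    (tsupport_comp_subset_preimage f (translate p).continuous (tsupport_mul_subset_left heζ))
  have hmid := hUc.translate_segment_mem hs hstart hend
  rwa [Homeomorph.apply_symm_apply] at hmid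

lemma isLocallyConstant_integral_translate_symm {U : Set ℂ} {hU : U ⊆ disk}
    {ν : Measure (unitTangent U)} (hν : InvariantSmall hU ν) {X : Type*} [TopologicalSpace X]
    {γ : X → ℝ × ℝ} (hγ : Continuous γ) {F : unitTangent disk → ℝ}
    (hF : ∀ s, IsTest U (F ∘ (translate (γ s)).symm)) :
    IsLocallyConstant fun s => ∫ ζ, F ((translate (γ s)).symm (incl hU ζ)) ∂ν := by
  rw [IsLocallyConstant.iff_eventually_eq]
  intro s
  have hinv := hν _ (hF s).continuous (hF s).hasCompactSupport (hF s).tsupport_subset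
  have hdiff : Tendsto (fun s' => (aff (γ s'))⁻¹ * aff (γ s)) (𝓝 s) (𝓝 1) := by
    rw [← inv_mul_cancel (aff (γ s))]
    exact ((continuous_aff.comp hγ).inv.mul continuous_const).tendsto s
  filter_upwards [hdiff.eventually hinv] with s' hs'
  rw [← Function.comp_def F, ← Function.comp_def F]
  refine Eq.trans (integral_congr_ae (Eventually.of_forall fun ζ => ?_)) hs'.symm
  rw [Function.comp_apply, Function.comp_apply, ← rightAct_aff_inv, ← rightAct_aff_inv,
    ← rightAct_mul, Subgroup.coe_mul, mul_inv_cancel_right, Subgroup.coe_inv]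

lemma integral_comp_translate_mul {U : Set ℂ} {hU : U ⊆ disk} (hUc : IsHoroConvex U)
    {ν : Measure (unitTangent U)} (hν : InvariantSmall hU ν) {f h : unitTangent disk → ℝ}
    (hf : IsTest U f) (hh : IsTest U h) (p : ℝ × ℝ) :
    ∫ ζ, f (translate p (incl hU ζ)) * h (incl hU ζ) ∂ν =
      ∫ ζ, f (incl hU ζ) * h ((translate p).symm (incl hU ζ)) ∂ν := by
  let γ : unitInterval → ℝ × ℝ := fun s => (s * p.1, segmentHeight p.2 s)
  have hγ : Continuous γ := Continuous.prodMk (by fun_prop)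
    (Continuous.log (by fun_prop) fun s => (one_sub_add_mul_exp_pos p.2 s.2).ne')
  have hconst := (isLocallyConstant_integral_translate_symm hν hγ
    fun s => hf.comp_translate_mul hUc hh p s.2).apply_eq_of_preconnectedSpace 0 1
  have hγ0 : γ 0 = 0 := by simp [γ, segmentHeight]
  have hγ1 : γ 1 = p := by simp [γ, segmentHeight]
  have hzero : ∀ ζ, (translate 0).symm ζ = ζ := fun ζ => by
    rw [Homeomorph.symm_apply_eq, translate_zero]
  simpa only [hγ0, hγ1, hzero, Homeomorph.apply_symm_apply] using hconst

lemma lintegral_mul_comp_translate {U : Set ℂ} {hU : U ⊆ disk} (hUc : IsHoroConvex U)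
    {ν : Measure (unitTangent U)} [IsLocallyFiniteMeasure ν] (hν : InvariantSmall hU ν)
    {f h : unitTangent disk → ℝ} (hf : IsTest U f) (hf0 : 0 ≤ f) (hh : IsTest U h) (hh0 : 0 ≤ h)
    (p : ℝ × ℝ) :
    ∫⁻ ζ, ENNReal.ofReal (h (incl hU ζ)) * ENNReal.ofReal (f (translate p (incl hU ζ))) ∂ν =
      ∫⁻ ζ, ENNReal.ofReal (f (incl hU ζ)) *
        ENNReal.ofReal (h ((translate p).symm (incl hU ζ))) ∂ν := by
  have hleft : IsTest U fun ζ => f (translate p ζ) * h ζ :=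
    hh.mul_left (hf.continuous.comp (translate p).continuous)
  have hright : IsTest U fun ζ => h ((translate p).symm ζ) * f ζ :=
    hf.mul_left (hh.continuous.comp (translate p).symm.continuous)
  have heq := congrArg ENNReal.ofReal (integral_comp_translate_mul hUc hν hf hh p)
  simp_rw [mul_comm (f (incl hU _))] at heq
  rw [ofReal_integral_eq_lintegral_ofReal (hleft.integrable hU ν)
      (Eventually.of_forall fun ζ => mul_nonneg (hf0 _) (hh0 _)),
    ofReal_integral_eq_lintegral_ofReal (hright.integrable hU ν)
      (Eventually.of_forall fun ζ => mul_nonneg (hh0 _) (hf0 _))] at heq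
  simpa only [ENNReal.ofReal_mul (hf0 _), ENNReal.ofReal_mul (hh0 _), mul_comm] using heq

lemma lintegral_mul_lintegral_translate {U : Set ℂ} {hU : U ⊆ disk} (hUc : IsHoroConvex U)
    {ν : Measure (unitTangent U)} [IsLocallyFiniteMeasure ν] (hν : InvariantSmall hU ν)
    {f h : unitTangent disk → ℝ} (hf : IsTest U f) (hf0 : 0 ≤ f) (hh : IsTest U h)
    (hh0 : 0 ≤ h) :
    ∫⁻ ζ, ENNReal.ofReal (h (incl hU ζ)) *
        (∫⁻ p, ENNReal.ofReal (f (translate p (incl hU ζ)))) ∂ν =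
      ∫⁻ ζ, ENNReal.ofReal (f (incl hU ζ)) *
        (∫⁻ p, ENNReal.ofReal (h ((translate p).symm (incl hU ζ)))) ∂ν := by
  have hincl := continuous_incl hU
  have hfc := hf.continuous
  have hhc := hh.continuous
  have hbase : Continuous fun q : (ℝ × ℝ) × unitTangent U => incl hU q.2 :=
    hincl.comp continuous_snd
  have hleft : Measurable fun q : (ℝ × ℝ) × unitTangent U =>
      ENNReal.ofReal (h (incl hU q.2)) * ENNReal.ofReal (f (translate q.1 (incl hU q.2))) :=
    (hhc.comp hbase).measurable.ennreal_ofReal.mul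
      (hfc.comp (continuous_translate continuous_fst hbase)).measurable.ennreal_ofReal
  have hright : Measurable fun q : (ℝ × ℝ) × unitTangent U =>
      ENNReal.ofReal (f (incl hU q.2)) *
        ENNReal.ofReal (h ((translate q.1).symm (incl hU q.2))) :=
    (hfc.comp hbase).measurable.ennreal_ofReal.mul
      (hhc.comp (continuous_translate_symm continuous_fst hbase)).measurable.ennreal_ofReal
  simp_rw [← lintegral_const_mul' _ _ ENNReal.ofReal_ne_top]
  calc
    _ = ∫⁻ p : ℝ × ℝ, ∫⁻ ζ, ENNReal.ofReal (h (incl hU ζ)) *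
          ENNReal.ofReal (f (translate p (incl hU ζ))) ∂ν :=
      (lintegral_lintegral_swap hleft.aemeasurable).symm
    _ = ∫⁻ p : ℝ × ℝ, ∫⁻ ζ, ENNReal.ofReal (f (incl hU ζ)) *
          ENNReal.ofReal (h ((translate p).symm (incl hU ζ))) ∂ν :=
      lintegral_congr fun p => lintegral_mul_comp_translate hUc hν hf hf0 hh hh0 p
    _ = _ := lintegral_lintegral_swap hright.aemeasurable

/-! ### Integration over orbits -/

lemma lintegral_comp_add_mul {a : ℝ} (ha : a ≠ 0) (b : ℝ) {g : ℝ → ℝ≥0∞} (hg : Measurable g) :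
    ∫⁻ x, g (b + a * x) = ENNReal.ofReal |a⁻¹| * ∫⁻ x, g x := by
  rw [← lintegral_add_left_eq_self (μ := volume) g b,
    ← lintegral_map (f := fun x => g (b + x)) (by fun_prop) (measurable_const_mul a),
    Real.map_volume_mul_left ha, lintegral_smul_measure, smul_eq_mul]

/-- Integral of a function over an orbit of the affine group, with respect to right Haar measure. -/
noncomputable def orbitLIntegral (F : unitTangent disk → ℝ≥0∞) (θ : circle) : ℝ≥0∞ :=
  ∫⁻ p : ℝ × ℝ, F (orbitPt p.1 p.2 θ)

lemma measurable_comp_orbitPt {F : unitTangent disk → ℝ≥0∞} (hF : Measurable F) (θ : circle) :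
    Measurable fun p : ℝ × ℝ => F (orbitPt p.1 p.2 θ) :=
  hF.comp (continuous_orbitPt continuous_fst continuous_snd continuous_const).measurable

lemma measurable_orbitLIntegral {F : unitTangent disk → ℝ≥0∞} (hF : Measurable F) :
    Measurable (orbitLIntegral F) :=
  Measurable.lintegral_prod_right' (f := fun q : circle × ℝ × ℝ => F (orbitPt q.2.1 q.2.2 q.1))
    (hF.comp (continuous_orbitPt (by fun_prop) (by fun_prop) (by fun_prop)).measurable)

lemma lintegral_comp_add_exp_mul {g : ℝ × ℝ → ℝ≥0∞} (hg : Measurable g) (x t : ℝ) :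
    ∫⁻ p : ℝ × ℝ, g (x + Real.exp t * p.1, t + p.2) =
      ENNReal.ofReal (Real.exp (-t)) * ∫⁻ p, g p := by
  have hfst : ∀ s, ∫⁻ x', g (x + Real.exp t * x', t + s) =
      ENNReal.ofReal (Real.exp (-t)) * ∫⁻ x', g (x', t + s) := fun s => by
    rw [lintegral_comp_add_mul (g := fun x' => g (x', t + s)) (Real.exp_pos _).ne' _
      (hg.comp (by fun_prop)), ← Real.exp_neg, abs_of_pos (Real.exp_pos _)]
  have hm : Measurable fun s => ∫⁻ x', g (x', s) := Measurable.lintegral_prod_left' hg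
  rw [Measure.volume_eq_prod,
    lintegral_prod_symm' (fun p : ℝ × ℝ => g (x + Real.exp t * p.1, t + p.2))
      (hg.comp (by fun_prop)), lintegral_prod_symm' _ hg]
  simp_rw [hfst]
  rw [lintegral_const_mul (f := fun s => ∫⁻ x', g (x', t + s)) _
      (hm.comp (measurable_const_add t)),
    lintegral_add_left_eq_self (μ := volume) (fun s => ∫⁻ x', g (x', s)) t]

lemma lintegral_exp_mul_comp_sub_exp_mul {g : ℝ × ℝ → ℝ≥0∞} (hg : Measurable g) (x t : ℝ) :
    ∫⁻ p : ℝ × ℝ, ENNReal.ofReal (Real.exp (t - p.2)) *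
      g (x - Real.exp (t - p.2) * p.1, t - p.2) = ∫⁻ p, g p := by
  have hfst : ∀ s, ∫⁻ x', ENNReal.ofReal (Real.exp (t - s)) *
      g (x - Real.exp (t - s) * x', t - s) = ∫⁻ x', g (x', t - s) := fun s => by
    simp_rw [sub_eq_add_neg x, ← neg_mul]
    rw [lintegral_const_mul (f := fun x' => g (x + -Real.exp (t - s) * x', t - s)) _
        (hg.comp (by fun_prop)),
      lintegral_comp_add_mul (g := fun x' => g (x', t - s)) (neg_ne_zero.2 (Real.exp_pos _).ne') _
        (hg.comp (by fun_prop)), abs_inv, abs_neg,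
      abs_of_pos (Real.exp_pos _), ← mul_assoc, ← ENNReal.ofReal_mul (Real.exp_pos _).le,
      mul_inv_cancel₀ (Real.exp_pos _).ne', ENNReal.ofReal_one, one_mul]
  rw [Measure.volume_eq_prod,
    lintegral_prod_symm' (fun p : ℝ × ℝ => ENNReal.ofReal (Real.exp (t - p.2)) *
      g (x - Real.exp (t - p.2) * p.1, t - p.2))
      (Measurable.mul (by fun_prop) (hg.comp (by fun_prop))), lintegral_prod_symm' _ hg]
  simp_rw [hfst]
  exact lintegral_sub_left_eq_self (μ := volume) (fun s => ∫⁻ x', g (x', s)) t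

lemma lintegral_translate {F : unitTangent disk → ℝ≥0∞} (hF : Measurable F)
    (ζ : unitTangent disk) :
    ∫⁻ p : ℝ × ℝ, F (translate p ζ) =
      ENNReal.ofReal (Real.exp (-height ζ)) * orbitLIntegral F (endpoint ζ) :=
  lintegral_comp_add_exp_mul (measurable_comp_orbitPt hF (endpoint ζ)) _ _

lemma lintegral_translate_symm {F : unitTangent disk → ℝ≥0∞} (hF : Measurable F)
    (ζ : unitTangent disk) :
    ∫⁻ p : ℝ × ℝ, ENNReal.ofReal (Real.exp (height ((translate p).symm ζ))) *
        F ((translate p).symm ζ) = orbitLIntegral F (endpoint ζ) := by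
  simp_rw [translate_symm_apply, height_orbitPt]
  exact lintegral_exp_mul_comp_sub_exp_mul (measurable_comp_orbitPt hF (endpoint ζ)) _ _

lemma lintegral_mul_orbitLIntegral_comm {U : Set ℂ} {hU : U ⊆ disk} (hUc : IsHoroConvex U)
    {ν : Measure (unitTangent U)} [IsLocallyFiniteMeasure ν] (hν : InvariantSmall hU ν)
    {f h : unitTangent disk → ℝ} (hf : IsTest U f) (hf0 : 0 ≤ f) (hh : IsTest U h)
    (hh0 : 0 ≤ h) :
    ∫⁻ ζ, ENNReal.ofReal (h (incl hU ζ)) *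
        orbitLIntegral (fun ξ => ENNReal.ofReal (f ξ)) (endpoint (incl hU ζ)) ∂ν =
      ∫⁻ ζ, ENNReal.ofReal (f (incl hU ζ)) *
        orbitLIntegral (fun ξ => ENNReal.ofReal (h ξ)) (endpoint (incl hU ζ)) ∂ν := by
  have hfm : Measurable fun ξ => ENNReal.ofReal (f ξ) := hf.continuous.measurable.ennreal_ofReal
  have hhm : Measurable fun ξ => ENNReal.ofReal (h ξ) := hh.continuous.measurable.ennreal_ofReal
  have hcancel : ∀ (t : ℝ) (a b : ℝ≥0∞),
      ENNReal.ofReal (Real.exp t) * a * (ENNReal.ofReal (Real.exp (-t)) * b) = a * b := by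
    intro t a b
    rw [mul_mul_mul_comm, ← ENNReal.ofReal_mul (Real.exp_pos t).le, ← Real.exp_add,
      add_neg_cancel, Real.exp_zero, ENNReal.ofReal_one, one_mul]
  -- The weight `e^height` on `h` compensates the modular function of the affine group.
  have hweighted := lintegral_mul_lintegral_translate hUc hν hf hf0
    (hh.mul_left (Real.continuous_exp.comp continuous_height))
    (fun ζ => mul_nonneg (Real.exp_pos _).le (hh0 ζ))
  simpa only [lintegral_translate hfm, lintegral_translate_symm hhm, Function.comp_apply,
    ENNReal.ofReal_mul (Real.exp_pos _).le, hcancel] using hweighted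

/-! ### Area in horocyclic coordinates -/

lemma lintegral_comp_exp (u : ℝ → ℝ≥0∞) :
    ∫⁻ t, u (Real.exp t) = ∫⁻ y in Set.Ioi 0, ENNReal.ofReal y⁻¹ * u y := by
  rw [← Real.range_exp, ← Set.image_univ,
    lintegral_image_eq_lintegral_abs_deriv_mul MeasurableSet.univ
      (fun x _ => (Real.hasDerivAt_exp x).hasDerivWithinAt) Real.exp_injective.injOn,
    setLIntegral_univ]
  refine lintegral_congr fun t => ?_
  rw [← mul_assoc, ← ENNReal.ofReal_mul (abs_nonneg _), abs_of_pos (Real.exp_pos t),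
    mul_inv_cancel₀ (Real.exp_pos t).ne', ENNReal.ofReal_one, one_mul]

lemma measurableSet_im_pos : MeasurableSet {w : ℂ | 0 < w.im} :=
  measurableSet_lt measurable_const measurable_im

lemma lintegral_halfPlanePt {H : ℂ → ℝ≥0∞} (hH : Measurable H) :
    ∫⁻ p : ℝ × ℝ, H (halfPlanePt p.1 p.2) =
      ∫⁻ w in {w : ℂ | 0 < w.im}, ENNReal.ofReal w.im⁻¹ * H w := by
  have hc : Continuous fun p : ℝ × ℝ => halfPlanePt p.1 p.2 := by
    unfold halfPlanePt
    fun_prop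
  let K : ℂ → ℝ≥0∞ := {w : ℂ | 0 < w.im}.indicator fun w => ENNReal.ofReal w.im⁻¹ * H w
  have hK : Measurable K := (Measurable.mul (by fun_prop) hH).indicator measurableSet_im_pos
  rw [← lintegral_indicator measurableSet_im_pos]
  change _ = ∫⁻ w, K w
  rw [← volume_preserving_equiv_real_prod.symm.lintegral_comp_emb
      measurableEquivRealProd.symm.measurableEmbedding, Measure.volume_eq_prod,
    lintegral_prod (fun p : ℝ × ℝ => H (halfPlanePt p.1 p.2)) (hH.comp hc.measurable).aemeasurable,
    lintegral_prod (fun p => K (measurableEquivRealProd.symm p))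
      (hK.comp measurableEquivRealProd.symm.measurable).aemeasurable]
  refine lintegral_congr fun x => ?_
  simp_rw [halfPlanePt, lintegral_comp_exp fun y => H (x + y * I)]
  rw [← lintegral_indicator measurableSet_Ioi]
  refine lintegral_congr fun y => ?_
  have hpoint : measurableEquivRealProd.symm (x, y) = x + y * I := by
    apply Complex.ext <;> simp [measurableEquivRealProd_symm_apply]
  rw [hpoint]
  simp [K, Set.indicator_apply]

lemma hasDerivAt_cayley {w : ℂ} (hw : 0 < w.im) (θ : circle) :
    HasDerivAt (cayley θ) (θ * (2 * I / (w + I) ^ 2)) w := by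
  have hquot := (((hasDerivAt_id w).sub_const I).div ((hasDerivAt_id w).add_const I)
    (add_I_ne_zero hw)).const_mul (θ : ℂ)
  refine hquot.congr_deriv ?_
  rw [id]
  ring

lemma injOn_cayley (θ : circle) : Set.InjOn (cayley θ) {w | 0 < w.im} :=
  Set.LeftInvOn.injOn (f₁' := cayleyInv θ) fun _ hw => cayleyInv_cayley hw θ

lemma image_cayley (θ : circle) : cayley θ '' {w : ℂ | 0 < w.im} = disk := by
  refine Set.Subset.antisymm (Set.image_subset_iff.2 fun w hw => cayley_mem_disk hw θ)
    fun z hz => ⟨cayleyInv θ z, ?_, cayley_cayleyInv hz θ⟩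
  rw [Set.mem_ofPred_eq, cayleyInv_im]
  exact poissonKernel_pos hz θ

lemma lintegral_cayley (G : ℂ → ℝ≥0∞) (θ : circle) :
    ∫⁻ z in disk, G z = ∫⁻ w in {w : ℂ | 0 < w.im},
      ENNReal.ofReal (4 / ‖w + I‖ ^ 4) * G (cayley θ w) := by
  have hdet : ∀ a : ℂ, ((ContinuousLinearMap.toSpanSingleton ℂ a).restrictScalars ℝ).det
      = normSq a := fun a => by
    simp [ContinuousLinearMap.det, LinearMap.det_restrictScalars, Algebra.norm_complex_eq]
  have hnormSq : ∀ w, normSq ((θ : ℂ) * (2 * I / (w + I) ^ 2)) = 4 / ‖w + I‖ ^ 4 := fun w => by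
    simp only [normSq_eq_norm_sq, norm_mul, norm_circle, norm_div, norm_I, norm_pow,
      Complex.norm_ofNat]
    ring
  rw [← image_cayley θ, lintegral_image_eq_lintegral_abs_det_fderiv_mul volume measurableSet_im_pos
    (fun w hw => ((hasDerivAt_cayley hw θ).hasFDerivAt.restrictScalars ℝ).hasFDerivWithinAt)
    (injOn_cayley θ)]
  refine setLIntegral_congr_fun measurableSet_im_pos fun w _ => ?_
  simp only [hdet, hnormSq]
  rw [abs_of_nonneg (by positivity)]

lemma lintegral_cayley_halfPlanePt {G : ℂ → ℝ≥0∞} (hG : Measurable G) (θ : circle) :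
    ∫⁻ p : ℝ × ℝ, G (cayley θ (halfPlanePt p.1 p.2)) =
      ∫⁻ z in disk, ENNReal.ofReal (4 / (1 - ‖z‖ ^ 2) ^ 2) *
        (G z * ENNReal.ofReal (poissonKernel 0 z θ)) := by
  have hcayley : Measurable (cayley θ) := by
    unfold cayley
    fun_prop
  rw [lintegral_halfPlanePt (H := fun w => G (cayley θ w)) (hG.comp hcayley), lintegral_cayley _ θ]
  refine setLIntegral_congr_fun measurableSet_im_pos fun w (hw : 0 < w.im) => ?_
  have h := norm_pos_iff.2 (add_I_ne_zero hw)
  simp only [poissonKernel_cayley hw, one_sub_norm_cayley_sq hw]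
  rw [mul_comm (G _), ← mul_assoc, ← mul_assoc, ← ENNReal.ofReal_mul (by positivity),
    ← ENNReal.ofReal_mul (by positivity)]
  congr 2
  field_simp

lemma lintegral_area {U : Set ℂ} (hU : MeasurableSet U) {G : ℂ → ℝ≥0∞} (hG : Measurable G) :
    ∫⁻ z : U, G z ∂(area U) = ∫⁻ z in U, ENNReal.ofReal (4 / (1 - ‖z‖ ^ 2) ^ 2) * G z := by
  rw [area, lintegral_subtype_comap hU, restrict_withDensity hU,
    lintegral_withDensity_eq_lintegral_mul _ (by fun_prop) hG]
  rfl

lemma lintegral_cayley_halfPlanePt_eq_area {U : Set ℂ} (hU : U ⊆ disk) (hUm : MeasurableSet U)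
    {G : ℂ → ℝ≥0∞} (hG : Measurable G) (hG0 : ∀ z ∉ U, G z = 0) (θ : circle) :
    ∫⁻ p : ℝ × ℝ, G (cayley θ (halfPlanePt p.1 p.2)) =
      ∫⁻ z : U, G z * ENNReal.ofReal (poissonKernel 0 z θ) ∂(area U) := by
  have hk : Measurable fun z => ENNReal.ofReal (poissonKernel 0 z θ) := by
    unfold poissonKernel
    fun_prop
  rw [lintegral_cayley_halfPlanePt hG,
    lintegral_area hUm (G := fun z => G z * ENNReal.ofReal (poissonKernel 0 z θ)) (hG.mul hk)]
  have hsupp : (fun z => ENNReal.ofReal (4 / (1 - ‖z‖ ^ 2) ^ 2) *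
      (G z * ENNReal.ofReal (poissonKernel 0 z θ))).support ⊆ U := by
    refine Function.support_subset_iff'.2 fun z hz => ?_
    rw [hG0 z hz, zero_mul, mul_zero]
  rw [setLIntegral_eq_of_support_subset hsupp, setLIntegral_eq_of_support_subset (hsupp.trans hU)]

/-! ### The measure attached to a measure on the circle -/

lemma sigmaFinite_area {U : Set ℂ} (hU : MeasurableSet U) : SigmaFinite (area U) := by
  have : SigmaFinite (volume.withDensity fun z : ℂ => ENNReal.ofReal (4 / (1 - ‖z‖ ^ 2) ^ 2)) :=
    SigmaFinite.withDensity_of_ne_top (Eventually.of_forall fun _ => ENNReal.ofReal_ne_top)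
  refine SigmaFinite.of_map _ measurable_subtype_coe.aemeasurable ?_
  rw [area, (MeasurableEmbedding.subtype_coe hU).map_comap]
  infer_instance

lemma continuous_poissonKernel {X : Type*} [TopologicalSpace X] {z : X → ℂ} {θ : X → circle}
    (hz : Continuous z) (hθ : Continuous θ) (hzd : ∀ x, z x ∈ disk) :
    Continuous fun x => poissonKernel 0 (z x) (θ x) := by
  unfold poissonKernel
  refine Continuous.div (by fun_prop) (by fun_prop) fun x => ?_
  rw [sub_zero, sub_zero]
  exact pow_ne_zero _ (norm_ne_zero_iff.2 (circle_sub_ne_zero (hzd x) (θ x)))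

lemma measurable_ofReal_poissonKernel {U : Set ℂ} (hU : U ⊆ disk) :
    Measurable fun p : circle × U => ENNReal.ofReal (poissonKernel 0 (p.2 : ℂ) (p.1 : ℂ)) :=
  (continuous_poissonKernel (continuous_subtype_val.comp continuous_snd) continuous_fst
    fun p => hU p.2.2).measurable.ennreal_ofReal

/-- The measure `k(z, θ) dz dφ(θ)` on `T¹U`. -/
noncomputable def poissonMeasure {U : Set ℂ} (hU : U ⊆ disk) (φ : Measure circle) :
    Measure (unitTangent U) :=
  ((φ.prod (area U)).withDensity fun p => ENNReal.ofReal (poissonKernel 0 (p.2 : ℂ) (p.1 : ℂ))).map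
    fun p => toward hU p.2 p.1

lemma lintegral_poissonMeasure {U : Set ℂ} (hU : U ⊆ disk) (hUm : MeasurableSet U)
    (φ : Measure circle) {F : unitTangent U → ℝ≥0∞} (hF : Measurable F) :
    ∫⁻ ζ, F ζ ∂(poissonMeasure hU φ) = poissonLIntegral φ fun z θ => F (toward hU z θ) := by
  have := sigmaFinite_area hUm
  have htoward : Measurable fun p : circle × U => toward hU p.2 p.1 :=
    ((continuous_toward hU).comp continuous_swap).measurable
  have hk := measurable_ofReal_poissonKernel hU
  have hFm : Measurable fun p : circle × U => F (toward hU p.2 p.1) := hF.comp htoward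
  rw [poissonMeasure, lintegral_map hF htoward, lintegral_withDensity_eq_lintegral_mul _ hk hFm,
    lintegral_prod _ (hk.mul hFm).aemeasurable, poissonLIntegral]
  exact lintegral_congr fun θ => lintegral_congr fun z => mul_comm _ _

lemma poissonLIntegral_withDensity {U : Set ℂ} (hU : U ⊆ disk) (hUm : MeasurableSet U)
    (φ : Measure circle) {w : circle → ℝ≥0∞} (hw : Measurable w)
    {F : U → circle → ℝ≥0∞} (hF : Measurable fun p : circle × U => F p.2 p.1) :
    poissonLIntegral (φ.withDensity w) F = poissonLIntegral φ fun z θ => w θ * F z θ := by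
  have := sigmaFinite_area hUm
  have hm : Measurable fun p : circle × U =>
      F p.2 p.1 * ENNReal.ofReal (poissonKernel 0 (p.2 : ℂ) (p.1 : ℂ)) :=
    hF.mul (measurable_ofReal_poissonKernel hU)
  unfold poissonLIntegral
  rw [lintegral_withDensity_eq_lintegral_mul _ hw hm.lintegral_prod_right']
  refine lintegral_congr fun θ => ?_
  have hmθ : Measurable fun z : U => F z θ * ENNReal.ofReal (poissonKernel 0 (z : ℂ) (θ : ℂ)) :=
    hm.comp measurable_prodMk_left
  rw [Pi.mul_apply, ← lintegral_const_mul _ hmθ]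
  exact lintegral_congr fun z => (mul_assoc _ _ _).symm

lemma orbitLIntegral_eq_lintegral_area {U : Set ℂ} (hU : U ⊆ disk) (hUm : MeasurableSet U)
    {F : unitTangent disk → ℝ≥0∞} (hF : Measurable F) (hF0 : ∀ ζ, ζ.1.1 ∉ U → F ζ = 0)
    (θ : circle) :
    orbitLIntegral F θ =
      ∫⁻ z, F (incl hU (toward hU z θ)) *
        ENNReal.ofReal (poissonKernel 0 (z : ℂ) (θ : ℂ)) ∂(area U) := by
  let G : ℂ → ℝ≥0∞ := Function.extend ((↑) : U → ℂ) (fun z => F (incl hU (toward hU z θ))) 0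
  have hG : Measurable G := (MeasurableEmbedding.subtype_coe hUm).measurable_extend
    (hF.comp ((continuous_incl hU).comp ((continuous_toward hU).comp
      (Continuous.prodMk_left θ))).measurable) measurable_const
  have hGU : ∀ z : U, G z = F (incl hU (toward hU z θ)) :=
    Subtype.val_injective.extend_apply _ _
  have hG0 : ∀ z ∉ U, G z = 0 := fun z hz =>
    Function.extend_apply' _ _ _ fun ⟨u, hu⟩ => hz (hu ▸ u.2)
  have horbit : ∀ p : ℝ × ℝ, F (orbitPt p.1 p.2 θ) = G (cayley θ (halfPlanePt p.1 p.2)) := by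
    intro p
    by_cases hp : (orbitPt p.1 p.2 θ).1.1 ∈ U
    · exact (hGU ⟨_, hp⟩).symm
    · rw [hF0 _ hp, ← orbitPt_fst, hG0 _ hp]
  simp_rw [orbitLIntegral, horbit, ← hGU]
  exact lintegral_cayley_halfPlanePt_eq_area hU hUm hG hG0 θ

/-! ### Test functions -/

lemma isFiniteMeasureOnCompacts_of_lintegral_lt_top {X : Type*} [TopologicalSpace X] [T2Space X]
    [LocallyCompactSpace X] [MeasurableSpace X] [BorelSpace X] {ν : Measure X}
    (h : ∀ f : X → ℝ, Continuous f → HasCompactSupport f → 0 ≤ f →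
      ∫⁻ x, ENNReal.ofReal (f x) ∂ν < ∞) : IsFiniteMeasureOnCompacts ν := by
  refine ⟨fun K hK => ?_⟩
  obtain ⟨f, hf1, -, hfs, hf01⟩ := exists_continuous_one_zero_of_isCompact hK isClosed_empty
    (Set.disjoint_empty K)
  have hKf : K.indicator 1 ≤ fun x => ENNReal.ofReal (f x) :=
    Set.indicator_le fun x hx => by simp [hf1 hx]
  calc ν K = ∫⁻ x, K.indicator 1 x ∂ν := (lintegral_indicator_one hK.measurableSet).symm
    _ ≤ ∫⁻ x, ENNReal.ofReal (f x) ∂ν := lintegral_mono hKf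
    _ < ∞ := h f f.continuous hfs fun x => (hf01 x).1

lemma withDensity_le_smul {X : Type*} [MeasurableSpace X] (ν : Measure X) {f : X → ℝ≥0∞}
    {C : NNReal} (h : ∀ x, f x ≤ C) : ν.withDensity f ≤ C • ν := by
  rw [show C • ν = (C : ℝ≥0∞) • ν from rfl, ← withDensity_const]
  exact withDensity_mono (Eventually.of_forall h)

lemma measure_eq_of_lintegral_ofReal_eq {X : Type*} [MetricSpace X] [LocallyCompactSpace X]
    [SecondCountableTopology X] [MeasurableSpace X] [BorelSpace X] {μ ν : Measure X}
    [IsLocallyFiniteMeasure μ]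
    (h : ∀ f : X → ℝ, Continuous f → HasCompactSupport f → 0 ≤ f →
      ∫⁻ x, ENNReal.ofReal (f x) ∂μ = ∫⁻ x, ENNReal.ofReal (f x) ∂ν) : μ = ν := by
  have : IsFiniteMeasureOnCompacts ν := by
    refine isFiniteMeasureOnCompacts_of_lintegral_lt_top fun f hf hs hf0 => ?_
    rw [← h f hf hs hf0]
    exact (hf.integrable_of_hasCompactSupport hs).lintegral_lt_top
  refine Measure.ext_of_integral_eq_on_compactlySupported_nnreal fun f => ?_
  have hc : Continuous fun x => (f x : ℝ) := NNReal.continuous_coe.comp f.continuous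
  have hs : HasCompactSupport fun x => (f x : ℝ) :=
    f.hasCompactSupport.comp_left (g := ((↑) : NNReal → ℝ)) NNReal.coe_zero
  have h0 : 0 ≤ fun x => (f x : ℝ) := fun x => (f x).2
  rw [integral_eq_lintegral_of_nonneg_ae (Eventually.of_forall h0) hc.aestronglyMeasurable,
    integral_eq_lintegral_of_nonneg_ae (Eventually.of_forall h0) hc.aestronglyMeasurable,
    h _ hc hs h0]

lemma isOpenEmbedding_incl {U : Set ℂ} (hU : U ⊆ disk) (hUo : IsOpen U) :
    IsOpenEmbedding (incl hU) := by
  refine ⟨IsEmbedding.inclusion (unitTangent_mono hU), ?_⟩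
  have hrange : Set.range (incl hU) = (fun ζ : unitTangent disk => ζ.1.1) ⁻¹' U := by
    ext ζ
    exact ⟨fun ⟨ξ, hξ⟩ => hξ ▸ ξ.2.1, fun h => ⟨⟨ζ.1, h, ζ.2.2⟩, rfl⟩⟩
  rw [hrange]
  exact hUo.preimage (by fun_prop)

lemma isTest_extend {U : Set ℂ} (hU : U ⊆ disk) (hUo : IsOpen U) {f : unitTangent U → ℝ}
    (hf : Continuous f) (hs : HasCompactSupport f) :
    IsTest U (Function.extend (incl hU) f 0) := by
  have hi := isOpenEmbedding_incl hU hUo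
  have hsub := hs.tsupport_extend_zero_subset hi.continuous
  refine ⟨continuous_of_tsupport fun ζ hζ => ?_, hs.extend_zero hi.continuous, fun ζ hζ => ?_⟩
  · obtain ⟨ξ, -, rfl⟩ := hsub hζ
    rw [← hi.continuousAt_iff, Function.extend_comp hi.injective]
    exact hf.continuousAt
  · obtain ⟨ξ, -, rfl⟩ := hsub hζ
    exact ξ.2.1

lemma extend_incl {U : Set ℂ} (hU : U ⊆ disk) (f : unitTangent U → ℝ) (ζ : unitTangent U) :
    Function.extend (incl hU) f 0 (incl hU ζ) = f ζ :=
  Function.Injective.extend_apply (Set.inclusion_injective (unitTangent_mono hU)) _ _ _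

lemma extend_incl_nonneg {U : Set ℂ} {hU : U ⊆ disk} {f : unitTangent U → ℝ} (hf0 : 0 ≤ f) :
    0 ≤ Function.extend (incl hU) f 0 := by
  intro ζ
  by_cases h : ∃ ξ, incl hU ξ = ζ
  · obtain ⟨ξ, rfl⟩ := h
    rw [extend_incl]
    exact hf0 ξ
  · rw [Function.extend_apply' _ _ _ h]

lemma IsTest.orbitLIntegral_eq {U : Set ℂ} (hU : U ⊆ disk) (hUm : MeasurableSet U)
    {f : unitTangent disk → ℝ} (hf : IsTest U f) (θ : circle) :
    orbitLIntegral (fun ζ => ENNReal.ofReal (f ζ)) θ =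
      ∫⁻ z, ENNReal.ofReal (f (incl hU (toward hU z θ))) *
        ENNReal.ofReal (poissonKernel 0 (z : ℂ) (θ : ℂ)) ∂(area U) := by
  refine orbitLIntegral_eq_lintegral_area hU hUm hf.continuous.measurable.ennreal_ofReal
    (fun ζ hζ => ?_) θ
  rw [image_eq_zero_of_notMem_tsupport fun h => hζ (hf.tsupport_subset h), ENNReal.ofReal_zero]

lemma exists_orbitLIntegral_le {f : unitTangent disk → ℝ} (hf : Continuous f)
    (hs : HasCompactSupport f) :
    ∃ C : NNReal, ∀ θ, orbitLIntegral (fun ζ => ENNReal.ofReal (f ζ)) θ ≤ C := by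
  obtain ⟨M, hM⟩ := hf.bounded_above_of_compact_support hs
  let K : Set (ℝ × ℝ) := (fun ζ => (abscissa ζ, height ζ)) '' tsupport f
  have hK : IsCompact K := IsCompact.image hs (continuous_abscissa.prodMk continuous_height)
  have hsupp : ∀ θ, (fun p : ℝ × ℝ => ENNReal.ofReal (f (orbitPt p.1 p.2 θ))).support ⊆ K := by
    intro θ p hp
    refine ⟨orbitPt p.1 p.2 θ, subset_tsupport f fun h => hp ?_, ?_⟩
    · simp only [h, ENNReal.ofReal_zero]
    · simp only [abscissa_orbitPt, height_orbitPt]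
  refine ⟨M.toNNReal * (volume K).toNNReal, fun θ => ?_⟩
  rw [ENNReal.coe_mul, ENNReal.coe_toNNReal hK.measure_lt_top.ne, orbitLIntegral,
    ← setLIntegral_eq_of_support_subset (hsupp θ), ← setLIntegral_const]
  exact lintegral_mono fun p => ENNReal.ofReal_le_ofReal ((Real.le_norm_self _).trans (hM _))

/-- A nonnegative bump function on the disk `|z - c| < r`, lifted to the unit tangent bundle. -/
noncomputable def bump (c : ℂ) (r : ℝ) (ζ : unitTangent disk) : ℝ := max 0 (r - ‖ζ.1.1 - c‖)

lemma bump_nonneg (c : ℂ) (r : ℝ) : 0 ≤ bump c r := fun _ => le_max_left _ _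

lemma isTest_bump {U : Set ℂ} (hU : U ⊆ disk) {c : ℂ} {r : ℝ}
    (hball : Metric.closedBall c r ⊆ U) : IsTest U (bump c r) := by
  have hsub : tsupport (bump c r) ⊆ {ζ | ζ.1.1 ∈ Metric.closedBall c r} := by
    refine closure_minimal (fun ζ hζ => ?_) (Metric.isClosed_closedBall.preimage (by fun_prop))
    rw [Set.mem_ofPred_eq, mem_closedBall_iff_norm]
    by_contra! h
    exact hζ (max_eq_left (by linarith))
  refine ⟨by unfold bump; fun_prop, ?_, fun ζ hζ => hball (hsub hζ)⟩
  have hK : IsCompact ((↑) ⁻¹' Metric.closedBall c r : Set disk) :=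
    Topology.IsInducing.subtypeVal.isCompact_preimage' (isCompact_closedBall _ _)
      (by rw [Subtype.range_coe]; exact hball.trans hU)
  refine IsCompact.of_isClosed_subset
    ((hK.prod (isCompact_univ (X := circle))).image (continuous_toward Set.Subset.rfl))
    (isClosed_tsupport _) fun ζ hζ => ?_
  exact ⟨(⟨ζ.1.1, ζ.2.1⟩, endpoint ζ), ⟨hsub hζ, trivial⟩, toward_endpoint ζ⟩

lemma le_poissonKernel {z : ℂ} (hz : z ∈ disk) (θ : circle) :
    (1 - ‖z‖ ^ 2) / 4 ≤ poissonKernel 0 z θ := by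
  have hpos := norm_pos_iff.2 (circle_sub_ne_zero hz θ)
  have hle : ‖(θ : ℂ) - z‖ ≤ 2 := by
    have := norm_sub_le (θ : ℂ) z
    rw [norm_circle] at this
    linarith [mem_disk.1 hz]
  rw [poissonKernel, sub_zero, sub_zero, norm_circle, one_pow]
  exact div_le_div_of_nonneg_left (one_sub_norm_sq_pos hz).le (by positivity) (by nlinarith)

lemma exists_le_orbitLIntegral_bump {c : ℂ} {r : ℝ} (hr : 0 < r) (hU : Metric.ball c r ⊆ disk) :
    ∃ ε : ℝ≥0∞, ε ≠ 0 ∧ ∀ θ, ε ≤ orbitLIntegral (fun ζ => ENNReal.ofReal (bump c r ζ)) θ := by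
  have hUm : MeasurableSet (Metric.ball c r) := Metric.isOpen_ball.measurableSet
  have hbm : Measurable fun ζ => ENNReal.ofReal (bump c r ζ) := by
    unfold bump
    fun_prop
  have hb0 : ∀ ζ : unitTangent disk, ζ.1.1 ∉ Metric.ball c r →
      ENNReal.ofReal (bump c r ζ) = 0 := by
    intro ζ hζ
    rw [mem_ball_iff_norm, not_lt] at hζ
    exact ENNReal.ofReal_eq_zero.2 (max_le le_rfl (sub_nonpos.2 hζ))
  let m : ℂ → ℝ≥0∞ := fun z => ENNReal.ofReal (max 0 (r - ‖z - c‖)) *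
    ENNReal.ofReal ((1 - ‖z‖ ^ 2) / 4)
  have hm : Measurable m := by fun_prop
  refine ⟨∫⁻ z : Metric.ball c r, m z ∂(area (Metric.ball c r)), ?_, fun θ => ?_⟩
  · rw [lintegral_area hUm hm, ← pos_iff_ne_zero, setLIntegral_pos_iff (by fun_prop)]
    refine (Metric.measure_ball_pos volume c hr).trans_le (measure_mono fun z hz => ⟨?_, hz⟩)
    have hz1 := one_sub_norm_sq_pos (hU hz)
    have hzr : 0 < max 0 (r - ‖z - c‖) := lt_max_of_lt_right (sub_pos.2 (mem_ball_iff_norm.1 hz))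
    have hpos : 0 < 4 / (1 - ‖z‖ ^ 2) ^ 2 := by positivity
    exact mul_ne_zero (ENNReal.ofReal_pos.2 hpos).ne'
      (mul_ne_zero (ENNReal.ofReal_pos.2 hzr).ne' (ENNReal.ofReal_pos.2 (by linarith)).ne')
  · rw [orbitLIntegral_eq_lintegral_area hU hUm hbm hb0]
    exact lintegral_mono fun z => mul_le_mul_right
      (ENNReal.ofReal_le_ofReal (le_poissonKernel (hU z.2) θ)) _

/-! ### Existence of the measure on the circle -/

/-- The image under `endpoint` of the measure `b ν`, for a density `b` on `T¹𝔻`. -/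
noncomputable def endpointMeasure {U : Set ℂ} (hU : U ⊆ disk) (ν : Measure (unitTangent U))
    (b : unitTangent disk → ℝ) : Measure circle :=
  (ν.withDensity fun ζ => ENNReal.ofReal (b (incl hU ζ))).map fun ζ => endpoint (incl hU ζ)

lemma measurable_endpoint_incl {U : Set ℂ} (hU : U ⊆ disk) :
    Measurable fun ζ => endpoint (incl hU ζ) :=
  (continuous_endpoint.comp (continuous_incl hU)).measurable

lemma lintegral_endpointMeasure {U : Set ℂ} (hU : U ⊆ disk) (ν : Measure (unitTangent U))
    {b : unitTangent disk → ℝ} (hb : Continuous b) {u : circle → ℝ≥0∞} (hu : Measurable u) :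
    ∫⁻ θ, u θ ∂(endpointMeasure hU ν b) =
      ∫⁻ ζ, ENNReal.ofReal (b (incl hU ζ)) * u (endpoint (incl hU ζ)) ∂ν := by
  have hbi : Measurable fun ζ => ENNReal.ofReal (b (incl hU ζ)) :=
    (hb.comp (continuous_incl hU)).measurable.ennreal_ofReal
  have hui : Measurable fun ζ => u (endpoint (incl hU ζ)) := hu.comp (measurable_endpoint_incl hU)
  rw [endpointMeasure, lintegral_map hu (measurable_endpoint_incl hU),
    lintegral_withDensity_eq_lintegral_mul _ hbi hui]
  rfl

lemma IsTest.isFiniteMeasure_endpointMeasure {U : Set ℂ} (hU : U ⊆ disk)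
    (ν : Measure (unitTangent U)) [IsLocallyFiniteMeasure ν] {b : unitTangent disk → ℝ}
    (hb : IsTest U b) : IsFiniteMeasure (endpointMeasure hU ν b) := by
  have : IsFiniteMeasure (ν.withDensity fun ζ => ENNReal.ofReal (b (incl hU ζ))) :=
    isFiniteMeasure_withDensity (hb.integrable hU ν).lintegral_lt_top.ne
  unfold endpointMeasure
  infer_instance

lemma withDensity_orbitLIntegral_eq_poissonMeasure {U : Set ℂ} {hU : U ⊆ disk} (hUo : IsOpen U)
    (hUc : IsHoroConvex U) {ν : Measure (unitTangent U)} [IsLocallyFiniteMeasure ν]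
    (hν : InvariantSmall hU ν) {b : unitTangent disk → ℝ} (hb : IsTest U b) (hb0 : 0 ≤ b) :
    (ν.withDensity fun ζ =>
      orbitLIntegral (fun ξ => ENNReal.ofReal (b ξ)) (endpoint (incl hU ζ))) =
      poissonMeasure hU (endpointMeasure hU ν b) := by
  set H := orbitLIntegral fun ξ => ENNReal.ofReal (b ξ)
  have hHi : Measurable fun ζ => H (endpoint (incl hU ζ)) :=
    (measurable_orbitLIntegral hb.continuous.measurable.ennreal_ofReal).comp
      (measurable_endpoint_incl hU)
  have : LocallyCompactSpace (unitTangent U) := (isOpenEmbedding_incl hU hUo).locallyCompactSpace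
  have : IsLocallyFiniteMeasure (ν.withDensity fun ζ => H (endpoint (incl hU ζ))) := by
    obtain ⟨C, hHC⟩ := exists_orbitLIntegral_le hb.continuous hb.hasCompactSupport
    exact Measure.isLocallyFiniteMeasure_of_le (withDensity_le_smul ν fun ζ => hHC _)
  refine measure_eq_of_lintegral_ofReal_eq fun f hf hs hf0 => ?_
  have hft := isTest_extend hU hUo hf hs
  have hcomm :=
    lintegral_mul_orbitLIntegral_comm hUc hν hft (extend_incl_nonneg (hU := hU) hf0) hb hb0
  have horbit := hft.orbitLIntegral_eq hU hUo.measurableSet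
  simp_rw [extend_incl] at horbit hcomm
  rw [lintegral_withDensity_eq_lintegral_mul _ hHi hf.measurable.ennreal_ofReal,
    lintegral_poissonMeasure hU hUo.measurableSet _ hf.measurable.ennreal_ofReal, poissonLIntegral,
    ← lintegral_congr horbit, lintegral_endpointMeasure hU ν hb.continuous
      (measurable_orbitLIntegral hft.continuous.measurable.ennreal_ofReal), hcomm]
  exact lintegral_congr fun ζ => mul_comm _ _

lemma lintegral_eq_poissonLIntegral_withDensity_inv {U : Set ℂ} {hU : U ⊆ disk}
    (hUm : MeasurableSet U) {ν : Measure (unitTangent U)} {ψ : Measure circle}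
    {H : circle → ℝ≥0∞} (hH : Measurable H) (hH0 : ∀ θ, H θ ≠ 0) (hHt : ∀ θ, H θ ≠ ∞)
    (h : (ν.withDensity fun ζ => H (endpoint (incl hU ζ))) = poissonMeasure hU ψ)
    {F : unitTangent U → ℝ≥0∞} (hF : Measurable F) :
    ∫⁻ ζ, F ζ ∂ν =
      poissonLIntegral (ψ.withDensity fun θ => (H θ)⁻¹) fun z θ => F (toward hU z θ) := by
  have hHi : Measurable fun ζ => H (endpoint (incl hU ζ)) := hH.comp (measurable_endpoint_incl hU)
  have hHF : Measurable fun ζ => (H (endpoint (incl hU ζ)))⁻¹ * F ζ := hHi.inv.mul hF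
  have hend : ∀ z θ, endpoint (incl hU (toward hU z θ)) = θ := fun z θ =>
    endpoint_toward ⟨z, hU z.2⟩ θ
  calc ∫⁻ ζ, F ζ ∂ν
      = ∫⁻ ζ, (H (endpoint (incl hU ζ)))⁻¹ * F ζ ∂(poissonMeasure hU ψ) := by
        rw [← h, lintegral_withDensity_eq_lintegral_mul _ hHi hHF]
        refine lintegral_congr fun ζ => ?_
        rw [Pi.mul_apply, ← mul_assoc, ENNReal.mul_inv_cancel (hH0 _) (hHt _), one_mul]
    _ = poissonLIntegral ψ fun z θ => (H θ)⁻¹ * F (toward hU z θ) := by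
        rw [lintegral_poissonMeasure hU hUm ψ hHF]
        simp_rw [hend]
    _ = poissonLIntegral (ψ.withDensity fun θ => (H θ)⁻¹) fun z θ => F (toward hU z θ) :=
        (poissonLIntegral_withDensity hU hUm ψ hH.inv
          (hF.comp ((continuous_toward hU).comp continuous_swap).measurable)).symm

theorem exists_lintegral_eq_poissonLIntegral {U : Set ℂ} {hU : U ⊆ disk} (hUo : IsOpen U)
    (hUn : U.Nonempty) (hUc : IsHoroConvex U) {ν : Measure (unitTangent U)}
    [IsLocallyFiniteMeasure ν] (hν : InvariantSmall hU ν) :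
    ∃ φ : Measure circle, IsFiniteMeasure φ ∧ ∀ F : unitTangent U → ℝ≥0∞, Measurable F →
      ∫⁻ ζ, F ζ ∂ν = poissonLIntegral φ fun z θ => F (toward hU z θ) := by
  obtain ⟨c, hc⟩ := hUn
  obtain ⟨r, hr, hball⟩ := Metric.nhds_basis_closedBall.mem_iff.1 (hUo.mem_nhds hc)
  have hb := isTest_bump hU hball
  obtain ⟨C, hHC⟩ := exists_orbitLIntegral_le hb.continuous hb.hasCompactSupport
  obtain ⟨ε, hε, hHε⟩ :=
    exists_le_orbitLIntegral_bump hr ((Metric.ball_subset_closedBall.trans hball).trans hU)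
  have hH := measurable_orbitLIntegral hb.continuous.measurable.ennreal_ofReal
  have hψ := hb.isFiniteMeasure_endpointMeasure hU ν
  have hfin : IsFiniteMeasure ((endpointMeasure hU ν (bump c r)).withDensity fun θ =>
      (orbitLIntegral (fun ζ => ENNReal.ofReal (bump c r ζ)) θ)⁻¹) := by
    refine isFiniteMeasure_of_le _ (withDensity_le_smul (C := ε⁻¹.toNNReal) _ fun θ => ?_)
    rw [ENNReal.coe_toNNReal (ENNReal.inv_ne_top.2 hε)]
    exact ENNReal.inv_le_inv.2 (hHε θ)
  refine ⟨_, hfin, fun F hF => lintegral_eq_poissonLIntegral_withDensity_inv hUo.measurableSet hH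
    (fun θ => ((pos_iff_ne_zero.2 hε).trans_le (hHε θ)).ne')
    (fun θ => ne_top_of_le_ne_top ENNReal.coe_ne_top (hHC θ))
    (withDensity_orbitLIntegral_eq_poissonMeasure hUo hUc hν hb (bump_nonneg c r)) hF⟩

/-! ### Measures on the circle and their Poisson integrals -/

lemma integrable_circle {E : Type*} [NormedAddCommGroup E] (φ : Measure circle)
    [IsFiniteMeasure φ] {f : circle → E} (hf : Continuous f) : Integrable f φ :=
  hf.integrable_of_hasCompactSupport (HasCompactSupport.of_compactSpace f)

lemma circle_measure_ext_of_monomial {φ φ' : Measure circle} [IsFiniteMeasure φ]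
    [IsFiniteMeasure φ']
    (h : ∀ m n : ℕ, ∫ θ, (θ : ℂ) ^ m * conj (θ : ℂ) ^ n ∂φ =
      ∫ θ, (θ : ℂ) ^ m * conj (θ : ℂ) ^ n ∂φ') : φ = φ' := by
  let X : BoundedContinuousFunction circle ℂ :=
    BoundedContinuousFunction.mkOfCompact ⟨fun θ => (θ : ℂ), continuous_subtype_val⟩
  let S : Submodule ℂ (BoundedContinuousFunction circle ℂ) :=
    { carrier := {f | ∫ θ, f θ ∂φ = ∫ θ, f θ ∂φ'}
      zero_mem' := by simp
      add_mem' := fun {f g} (hf : _ = _) (hg : _ = _) => by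
        simp only [Set.mem_ofPred_eq, BoundedContinuousFunction.add_apply]
        rw [integral_add (f.integrable φ) (g.integrable φ),
          integral_add (f.integrable φ') (g.integrable φ'), hf, hg]
      smul_mem' := fun a f (hf : _ = _) => by
        simp only [Set.mem_ofPred_eq, BoundedContinuousFunction.coe_smul, integral_smul, hf] }
  have hmonomial : ∀ f ∈ Submonoid.closure ({X} ∪ star {X}), f ∈ S := by
    intro f hf
    rw [Set.star_singleton, Set.singleton_union, Submonoid.mem_closure_pair] at hf
    obtain ⟨m, n, rfl⟩ := hf
    exact h m n
  refine ext_of_forall_mem_subalgebra_integral_eq_of_pseudoEMetric_complete_countable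
    (𝕜 := ℂ) (A := StarAlgebra.adjoin ℂ {X}) (fun θ₁ θ₂ hne => ?_) fun f hf => ?_
  · exact ⟨X, ⟨_, ⟨X, StarAlgebra.self_mem_adjoin_singleton ℂ X, rfl⟩, rfl⟩,
      fun h => hne (Subtype.ext h)⟩
  · refine (Submodule.span_le (p := S)).2 hmonomial ?_
    rwa [← StarAlgebra.adjoin_eq_span]

/-- The moments `∫ θ⁻ⁿ dφ(θ)` of a measure on the circle. -/
noncomputable def moment (φ : Measure circle) (n : ℕ) : ℂ := ∫ θ, conj (θ : ℂ) ^ n ∂φ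

lemma circle_measure_ext {φ φ' : Measure circle} [IsFiniteMeasure φ] [IsFiniteMeasure φ']
    (h : moment φ = moment φ') : φ = φ' := by
  have hconj : ∀ n, ∫ θ, conj (θ : ℂ) ^ n ∂φ = ∫ θ, conj (θ : ℂ) ^ n ∂φ' := congrFun h
  have hpow : ∀ n, ∫ θ, (θ : ℂ) ^ n ∂φ = ∫ θ, (θ : ℂ) ^ n ∂φ' := fun n => by
    simpa [← integral_conj] using congrArg conj (hconj n)
  have hmul : ∀ θ : circle, (θ : ℂ) * conj (θ : ℂ) = 1 := fun θ => by
    rw [conj_circle, mul_inv_cancel₀ (circle_ne_zero θ)]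
  refine circle_measure_ext_of_monomial fun m n => ?_
  rcases le_total n m with hle | hle
  · obtain ⟨k, rfl⟩ := Nat.exists_eq_add_of_le hle
    have hcancel : ∀ θ : circle, (θ : ℂ) ^ (n + k) * conj (θ : ℂ) ^ n = (θ : ℂ) ^ k := fun θ => by
      rw [pow_add, mul_right_comm, ← mul_pow, hmul, one_pow, one_mul]
    simp_rw [hcancel, hpow]
  · obtain ⟨k, rfl⟩ := Nat.exists_eq_add_of_le hle
    have hcancel : ∀ θ : circle, (θ : ℂ) ^ m * conj (θ : ℂ) ^ (m + k) = conj (θ : ℂ) ^ k :=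
      fun θ => by rw [pow_add, ← mul_assoc, ← mul_pow, hmul, one_pow, one_mul]
    simp_rw [hcancel, hconj]

/-- The Cauchy transform of a measure on the circle, holomorphic in the disk. -/
noncomputable def cauchyTransform (φ : Measure circle) (z : ℂ) : ℂ :=
  ∫ θ, (1 - conj (θ : ℂ) * z)⁻¹ ∂φ

lemma cauchyTransform_zero (φ : Measure circle) :
    cauchyTransform φ 0 = (φ.real Set.univ : ℂ) := by
  simp [cauchyTransform]

lemma norm_moment_le (φ : Measure circle) [IsFiniteMeasure φ] (n : ℕ) :
    ‖moment φ n‖ ≤ φ.real Set.univ := by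
  have hnorm : ∀ θ : circle, ‖conj (θ : ℂ) ^ n‖ ≤ 1 := fun θ => by
    rw [norm_pow, RCLike.norm_conj, norm_circle, one_pow]
  simpa only [moment, one_mul] using
    norm_integral_le_of_norm_le_const (μ := φ) (Eventually.of_forall hnorm)

lemma hasSum_cauchyTransform (φ : Measure circle) [IsFiniteMeasure φ] {z : ℂ} (hz : z ∈ disk) :
    HasSum (fun n => moment φ n * z ^ n) (cauchyTransform φ z) := by
  have hnorm : ∀ θ : circle, ‖conj (θ : ℂ) * z‖ = ‖z‖ := fun θ => by
    rw [norm_mul, RCLike.norm_conj, norm_circle, one_mul]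
  have hgeom : ∀ θ : circle, ∑' n : ℕ, (conj (θ : ℂ) * z) ^ n = (1 - conj (θ : ℂ) * z)⁻¹ :=
    fun θ => tsum_geometric_of_norm_lt_one ((hnorm θ).trans_lt (mem_disk.1 hz))
  have hsummable : Summable fun n : ℕ => ∫ θ, ‖(conj (θ : ℂ) * z) ^ n‖ ∂φ := by
    simp_rw [norm_pow, hnorm, integral_const, smul_eq_mul]
    exact (summable_geometric_of_lt_one (norm_nonneg z) (mem_disk.1 hz)).mul_left _
  have hsum := hasSum_integral_of_summable_integral_norm
    (fun n => integrable_circle φ (by fun_prop)) hsummable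
  simp_rw [hgeom, mul_pow, integral_mul_const] at hsum
  exact hsum

lemma eball_zero_one_eq_disk : Metric.eball (0 : ℂ) 1 = disk := by
  rw [disk, ← Metric.eball_ofReal, ENNReal.ofReal_one]

lemma hasFPowerSeriesOnBall_cauchyTransform (φ : Measure circle) [IsFiniteMeasure φ] :
    HasFPowerSeriesOnBall (cauchyTransform φ)
      (FormalMultilinearSeries.ofScalars ℂ (moment φ)) 0 1 where
  r_le := by
    rw [← ENNReal.coe_one]
    refine FormalMultilinearSeries.le_radius_of_bound _ (φ.real Set.univ) fun n => ?_
    rw [FormalMultilinearSeries.ofScalars_norm, NNReal.coe_one, one_pow, mul_one]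
    exact norm_moment_le φ n
  r_pos := one_pos
  hasSum := fun {z} hz => by
    simpa [FormalMultilinearSeries.ofScalars_apply_eq, mul_comm] using
      hasSum_cauchyTransform φ (eball_zero_one_eq_disk ▸ hz)

lemma analyticOnNhd_cauchyTransform (φ : Measure circle) [IsFiniteMeasure φ] :
    AnalyticOnNhd ℂ (cauchyTransform φ) disk :=
  eball_zero_one_eq_disk ▸ (hasFPowerSeriesOnBall_cauchyTransform φ).analyticOnNhd

lemma moment_eq_of_eqOn_cauchyTransform {φ φ' : Measure circle} [IsFiniteMeasure φ]
    [IsFiniteMeasure φ'] (h : Set.EqOn (cauchyTransform φ) (cauchyTransform φ') disk) :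
    moment φ = moment φ' := by
  have hseries := HasFPowerSeriesAt.eq_formalMultilinearSeries_of_eventually
    (hasFPowerSeriesOnBall_cauchyTransform φ).hasFPowerSeriesAt
    (hasFPowerSeriesOnBall_cauchyTransform φ').hasFPowerSeriesAt
    (h.eventuallyEq_of_mem (Metric.ball_mem_nhds 0 one_pos))
  funext n
  simpa only [FormalMultilinearSeries.coeff_ofScalars] using congrArg (fun p => p.coeff n) hseries

/-- The Poisson integral of a measure on the circle. -/
noncomputable def poissonIntegral (φ : Measure circle) (z : ℂ) : ℝ :=
  ∫ θ : circle, poissonKernel 0 z θ ∂φ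

lemma poissonIntegral_nonneg (φ : Measure circle) {z : ℂ} (hz : z ∈ disk) :
    0 ≤ poissonIntegral φ z :=
  integral_nonneg fun θ => (poissonKernel_pos hz θ).le

lemma poissonKernel_eq_re {z : ℂ} (hz : z ∈ disk) (θ : circle) :
    poissonKernel 0 z θ = 2 * ((1 - conj (θ : ℂ) * z)⁻¹).re - 1 := by
  have hsub := circle_sub_ne_zero hz θ
  have hθ := circle_ne_zero θ
  have hinv : (1 - conj (θ : ℂ) * z)⁻¹ = θ / (θ - z) := by
    rw [conj_circle]
    field_simp
  have hherglotz : ((θ : ℂ) + z) / (θ - z) = (2 : ℝ) * ((θ : ℂ) / (θ - z)) - 1 := by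
    field_simp
    push_cast
    ring
  rw [poissonKernel_eq_re_herglotzRieszKernel, Function.comp_apply, herglotzRieszKernel, sub_zero,
    sub_zero, hinv, hherglotz, sub_re, re_ofReal_mul, one_re]

lemma poissonIntegral_eq_re_cauchyTransform (φ : Measure circle) [IsFiniteMeasure φ] {z : ℂ}
    (hz : z ∈ disk) :
    poissonIntegral φ z = 2 * (cauchyTransform φ z).re - φ.real Set.univ := by
  have hcont : Continuous fun θ : circle => (1 - conj (θ : ℂ) * z)⁻¹ := by
    refine Continuous.inv₀ (by fun_prop) fun θ h => ?_
    have hone : ‖conj (θ : ℂ) * z‖ = 1 := by rw [← sub_eq_zero.1 h, norm_one]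
    rw [norm_mul, RCLike.norm_conj, norm_circle, one_mul] at hone
    exact (mem_disk.1 hz).ne hone
  have hre : ∫ θ : circle, ((1 - conj (θ : ℂ) * z)⁻¹).re ∂φ = (cauchyTransform φ z).re :=
    integral_re (integrable_circle φ hcont)
  have hintegrable : Integrable (fun θ : circle => 2 * ((1 - conj (θ : ℂ) * z)⁻¹).re) φ :=
    (integrable_circle φ (continuous_re.comp hcont)).const_mul 2
  simp_rw [poissonIntegral, poissonKernel_eq_re hz]
  rw [integral_sub hintegrable (integrable_const 1), integral_const_mul, hre, integral_const,
    smul_eq_mul, mul_one]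

lemma eqOn_const_of_eventually_re_eq {f : ℂ → ℂ} {V : Set ℂ} (hf : AnalyticOnNhd ℂ f V)
    (hV : IsPreconnected V) {z₀ : ℂ} (hz₀ : z₀ ∈ V) {a : ℝ} (h : ∀ᶠ z in 𝓝 z₀, (f z).re = a) :
    Set.EqOn f (fun _ => f z₀) V := by
  refine hf.eqOn_of_preconnected_of_eventuallyEq analyticOnNhd_const hV hz₀ ?_
  refine (hf z₀ hz₀).eventually_constant_or_nhds_le_map_nhds.resolve_right fun hopen => ?_
  have hline : ∀ᶠ x in 𝓝 (f z₀).re, x = a := isOpenMap_re.nhds_le _ (hopen h)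
  have hsingleton : {a} ∈ 𝓝 a := by
    rwa [h.self_of_nhds] at hline
  exact (not_isOpen_singleton a) (isOpen_singleton_iff_nhds_eq_pure a |>.2
    (le_antisymm (le_pure_iff.2 hsingleton) (pure_le_nhds a)))

theorem circle_measure_eq_of_eventually_poissonIntegral {φ φ' : Measure circle}
    [IsFiniteMeasure φ] [IsFiniteMeasure φ'] {z₀ : ℂ} (hz₀ : z₀ ∈ disk)
    (h : poissonIntegral φ =ᶠ[𝓝 z₀] poissonIntegral φ') : φ = φ' := by
  set M := φ.real Set.univ - φ'.real Set.univ
  have hre : ∀ᶠ z in 𝓝 z₀, ((cauchyTransform φ - cauchyTransform φ') z).re = M / 2 := by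
    filter_upwards [h, Metric.isOpen_ball.mem_nhds hz₀] with z hz hzd
    rw [poissonIntegral_eq_re_cauchyTransform φ hzd,
      poissonIntegral_eq_re_cauchyTransform φ' hzd] at hz
    rw [Pi.sub_apply, sub_re]
    linarith
  have hconst := eqOn_const_of_eventually_re_eq
    ((analyticOnNhd_cauchyTransform φ).sub (analyticOnNhd_cauchyTransform φ'))
    (convex_ball (0 : ℂ) 1).isPreconnected hz₀ hre
  have hz₀M : (cauchyTransform φ - cauchyTransform φ') z₀ = M := by
    refine (hconst (Metric.mem_ball_self one_pos)).symm.trans ?_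
    rw [Pi.sub_apply, cauchyTransform_zero, cauchyTransform_zero, ofReal_sub]
  have hM : M = 0 := by
    have := hre.self_of_nhds
    rw [hz₀M, ofReal_re] at this
    linarith
  refine circle_measure_ext (moment_eq_of_eqOn_cauchyTransform fun z hz => sub_eq_zero.1 ?_)
  simpa [hz₀M, hM] using hconst hz

lemma isOpenPosMeasure_area {U : Set ℂ} (hU : U ⊆ disk) (hUo : IsOpen U) :
    (area U).IsOpenPosMeasure := by
  refine ⟨fun V hV hVn => ne_of_gt ?_⟩
  have himage : IsOpen ((↑) '' V : Set ℂ) := hUo.isOpenMap_subtype_val V hV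
  have hdensity : ((↑) '' V : Set ℂ) ⊆
      Function.support fun z => ENNReal.ofReal (4 / (1 - ‖z‖ ^ 2) ^ 2) := by
    rintro _ ⟨z, -, rfl⟩
    have := one_sub_norm_sq_pos (hU z.2)
    rw [Function.mem_support, Ne, ENNReal.ofReal_eq_zero, not_le]
    positivity
  rw [area, (MeasurableEmbedding.subtype_coe hUo.measurableSet).comap_apply,
    withDensity_apply _ himage.measurableSet, setLIntegral_pos_iff (by fun_prop),
    Set.inter_eq_self_of_subset_right hdensity]
  exact himage.measure_pos volume (hVn.image _)

lemma continuous_poissonIntegral (φ : Measure circle) [IsFiniteMeasure φ] {U : Set ℂ}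
    (hU : U ⊆ disk) (hUo : IsOpen U) : Continuous fun z : U => poissonIntegral φ z := by
  have := hUo.locallyCompactSpace
  simpa only [poissonIntegral, Measure.restrict_univ] using
    continuous_parametric_integral_of_continuous (μ := φ)
      (continuous_poissonKernel (continuous_subtype_val.comp continuous_fst) continuous_snd
        fun p : U × circle => hU p.1.2) isCompact_univ

lemma ofReal_poissonIntegral (φ : Measure circle) [IsFiniteMeasure φ] {z : ℂ} (hz : z ∈ disk) :
    ENNReal.ofReal (poissonIntegral φ z) =
      ∫⁻ θ : circle, ENNReal.ofReal (poissonKernel 0 z θ) ∂φ := by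
  have hcont : Continuous fun θ : circle => poissonKernel 0 z θ :=
    continuous_poissonKernel continuous_const continuous_id fun _ => hz
  exact ofReal_integral_eq_lintegral_ofReal (integrable_circle φ hcont)
    (Eventually.of_forall fun θ => (poissonKernel_pos hz θ).le)

lemma poissonLIntegral_eq_lintegral (φ : Measure circle) [IsFiniteMeasure φ] {U : Set ℂ}
    (hU : U ⊆ disk) (hUo : IsOpen U) {G : U → ℝ≥0∞} (hG : Measurable G) :
    poissonLIntegral φ (fun z _ => G z) =
      ∫⁻ z, G z ∂((area U).withDensity fun z => ENNReal.ofReal (poissonIntegral φ z)) := by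
  have := sigmaFinite_area hUo.measurableSet
  have hprod : Measurable fun p : circle × U =>
      G p.2 * ENNReal.ofReal (poissonKernel 0 (p.2 : ℂ) (p.1 : ℂ)) :=
    (hG.comp measurable_snd).mul (measurable_ofReal_poissonKernel hU)
  rw [lintegral_withDensity_eq_lintegral_mul _
      (continuous_poissonIntegral φ hU hUo).measurable.ennreal_ofReal hG,
    poissonLIntegral, lintegral_lintegral_swap (f := fun (θ : circle) (z : U) =>
      G z * ENNReal.ofReal (poissonKernel 0 (z : ℂ) θ)) hprod.aemeasurable]
  refine lintegral_congr fun z => ?_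
  have hslice : Measurable fun θ : circle => ENNReal.ofReal (poissonKernel 0 (z : ℂ) θ) :=
    (continuous_poissonKernel continuous_const continuous_id
      fun _ => hU z.2).measurable.ennreal_ofReal
  rw [lintegral_const_mul _ hslice, Pi.mul_apply, ofReal_poissonIntegral φ (hU z.2), mul_comm]

theorem circle_measure_eq_of_poissonLIntegral {φ φ' : Measure circle} [IsFiniteMeasure φ]
    [IsFiniteMeasure φ'] {U : Set ℂ} (hU : U ⊆ disk) (hUo : IsOpen U) (hUn : U.Nonempty)
    (h : ∀ G : U → ℝ≥0∞, Measurable G →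
      poissonLIntegral φ (fun z _ => G z) = poissonLIntegral φ' fun z _ => G z) :
    φ = φ' := by
  have := sigmaFinite_area hUo.measurableSet
  have := isOpenPosMeasure_area hU hUo
  have hcont := ENNReal.continuous_ofReal.comp (continuous_poissonIntegral φ hU hUo)
  have hcont' := ENNReal.continuous_ofReal.comp (continuous_poissonIntegral φ' hU hUo)
  have hmeasure : ((area U).withDensity fun z => ENNReal.ofReal (poissonIntegral φ z)) =
      (area U).withDensity fun z => ENNReal.ofReal (poissonIntegral φ' z) :=
    Measure.ext_of_lintegral _ fun G hG => by
      rw [← poissonLIntegral_eq_lintegral φ hU hUo hG, ← poissonLIntegral_eq_lintegral φ' hU hUo hG,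
        h G hG]
  have hdensity := (hcont.ae_eq_iff_eq (area U) hcont').1 <|
    (withDensity_eq_iff_of_sigmaFinite hcont.aemeasurable hcont'.aemeasurable).1 hmeasure
  obtain ⟨z₀, hz₀⟩ := hUn
  refine circle_measure_eq_of_eventually_poissonIntegral (hU hz₀) ?_
  filter_upwards [hUo.mem_nhds hz₀] with z hz
  exact (ENNReal.ofReal_eq_ofReal_iff (poissonIntegral_nonneg φ (hU hz))
    (poissonIntegral_nonneg φ' (hU hz))).1 (congrFun hdensity ⟨z, hz⟩)

/-! ### Invariant lifts of a measure on `U` -/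

lemma continuous_proj {U : Set ℂ} : Continuous (proj (U := U)) :=
  Continuous.subtype_mk (continuous_fst.comp continuous_subtype_val) _

lemma isLocallyFiniteMeasure_of_map {X Y : Type*} [TopologicalSpace X] [MeasurableSpace X]
    [OpensMeasurableSpace X] [TopologicalSpace Y] [MeasurableSpace Y] [BorelSpace Y] {p : X → Y}
    (hp : Continuous p) (ν : Measure X) [IsLocallyFiniteMeasure (ν.map p)] :
    IsLocallyFiniteMeasure ν := by
  refine ⟨fun x => ?_⟩
  obtain ⟨V, hxV, hVo, hV⟩ := (ν.map p).exists_isOpen_measure_lt_top (p x)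
  rw [Measure.map_apply hp.measurable hVo.measurableSet] at hV
  exact ⟨p ⁻¹' V, hp.continuousAt.preimage_mem_nhds (hVo.mem_nhds hxV), hV⟩

theorem exists_poissonLIntegral_of_map_proj {U : Set ℂ} {hU : U ⊆ disk} (hUo : IsOpen U)
    (hUn : U.Nonempty) (hUc : IsHoroConvex U) {μ : Measure U} [IsLocallyFiniteMeasure μ]
    {ν : Measure (unitTangent U)} (hν : InvariantSmall hU ν) (hνμ : ν.map proj = μ) :
    ∃ φ : Measure circle, IsFiniteMeasure φ ∧
      (∀ F : unitTangent U → ℝ≥0∞, Measurable F →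
        ∫⁻ ζ, F ζ ∂ν = poissonLIntegral φ fun z θ => F (toward hU z θ)) ∧
      ∀ G : U → ℝ≥0∞, Measurable G →
        ∫⁻ z, G z ∂μ = poissonLIntegral φ fun z _ => G z := by
  subst hνμ
  have := isLocallyFiniteMeasure_of_map continuous_proj ν
  obtain ⟨φ, hφ, hF⟩ := exists_lintegral_eq_poissonLIntegral hUo hUn hUc hν
  refine ⟨φ, hφ, hF, fun G hG => ?_⟩
  rw [lintegral_map hG continuous_proj.measurable]
  exact hF _ (hG.comp continuous_proj.measurable)

end AffineLift

theorem proposition1_general {U : Set ℂ} (hU : U ⊆ AffineLift.disk) (hUo : IsOpen U)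
    (hUn : U.Nonempty) (hUc : AffineLift.IsHoroConvex U) (μ : Measure U)
    [IsLocallyFiniteMeasure μ] :
    (∀ ν₁ ν₂ : Measure (AffineLift.unitTangent U),
      AffineLift.InvariantSmall hU ν₁ → ν₁.map AffineLift.proj = μ →
      AffineLift.InvariantSmall hU ν₂ → ν₂.map AffineLift.proj = μ → ν₁ = ν₂) ∧
    (∀ ν : Measure (AffineLift.unitTangent U),
      AffineLift.InvariantSmall hU ν → ν.map AffineLift.proj = μ →
      ∃ φ : Measure AffineLift.circle, IsFiniteMeasure φ ∧
        (∀ F : AffineLift.unitTangent U → ℝ≥0∞, Measurable F →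
          ∫⁻ ζ, F ζ ∂ν =
            AffineLift.poissonLIntegral φ fun z θ => F (AffineLift.toward hU z θ)) ∧
        ∀ φ' : Measure AffineLift.circle, IsFiniteMeasure φ' →
          (∀ G : U → ℝ≥0∞, Measurable G →
            ∫⁻ z, G z ∂μ = AffineLift.poissonLIntegral φ' fun z _ => G z) →
          φ' = φ) := by
  refine ⟨fun ν₁ ν₂ hν₁ hμ₁ hν₂ hμ₂ => ?_, fun ν hν hνμ => ?_⟩
  · obtain ⟨φ₁, _, hF₁, hG₁⟩ :=
      AffineLift.exists_poissonLIntegral_of_map_proj hUo hUn hUc hν₁ hμ₁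
    obtain ⟨φ₂, _, hF₂, hG₂⟩ :=
      AffineLift.exists_poissonLIntegral_of_map_proj hUo hUn hUc hν₂ hμ₂
    have hφ : φ₁ = φ₂ := AffineLift.circle_measure_eq_of_poissonLIntegral hU hUo hUn
      fun G hG => (hG₁ G hG).symm.trans (hG₂ G hG)
    exact Measure.ext_of_lintegral _ fun F hF => by rw [hF₁ F hF, hF₂ F hF, hφ]
  · obtain ⟨φ, hφ, hF, hG⟩ :=
      AffineLift.exists_poissonLIntegral_of_map_proj hUo hUn hUc hν hνμ
    exact ⟨φ, hφ, hF, fun φ' _ hG' => AffineLift.circle_measure_eq_of_poissonLIntegral hU hUo hUn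
      fun G hGm => (hG' G hGm).symm.trans (hG G hGm)⟩

theorem proposition1 (c : ℂ) (r : ℝ) (hr : 0 < r) (hU : Metric.ball c r ⊆ AffineLift.disk)
    (μ : Measure (Metric.ball c r)) [IsProbabilityMeasure μ] :
    (∀ ν₁ ν₂ : Measure (AffineLift.unitTangent (Metric.ball c r)),
      AffineLift.InvariantSmall hU ν₁ → ν₁.map AffineLift.proj = μ →
      AffineLift.InvariantSmall hU ν₂ → ν₂.map AffineLift.proj = μ → ν₁ = ν₂) ∧
    (∀ ν : Measure (AffineLift.unitTangent (Metric.ball c r)),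
      AffineLift.InvariantSmall hU ν → ν.map AffineLift.proj = μ →
      ∃ φ : Measure AffineLift.circle, IsFiniteMeasure φ ∧
        (∀ F : AffineLift.unitTangent (Metric.ball c r) → ℝ≥0∞, Measurable F →
          ∫⁻ ζ, F ζ ∂ν =
            AffineLift.poissonLIntegral φ fun z θ => F (AffineLift.toward hU z θ)) ∧
        ∀ φ' : Measure AffineLift.circle, IsFiniteMeasure φ' →
          (∀ G : Metric.ball c r → ℝ≥0∞, Measurable G →
            ∫⁻ z, G z ∂μ = AffineLift.poissonLIntegral φ' fun z _ => G z) →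
          φ' = φ) :=
  proposition1_general hU Metric.isOpen_ball ⟨c, Metric.mem_ball_self hr⟩
    (AffineLift.isHoroConvex_ball hr.le hU) μ
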